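/- A copula is a function $C:[0,1]^2\to[0,1]$ with $C(0,x)=C(x,0)=0$ and $C(1,x)=C(x,1)=x$ for all $x\in[0,1]$, and $C(a,c)+C(b,d)-C(a,d)-C(b,c)\ge 0$ whenever $[a,b]\times[c,d]\subset[0,1]^2$. Write $C_{,i}$ for the partial derivative in the $i$-th variable. The fold product of copulas $A,B$ is the copula $(A*B)(x,y)=\int_0^1 A_{,2}(x,t)\,B_{,1}(t,y)\,dt$, and $C^1=C$, $C^n=C^{n-1}*C$ for $n>1$. For a copula $C$, put $$\alpha(C)=\sup_{A,B}\bigl|P(U\in A,\,V\in B)-\lambda(A)\lambda(B)\bigr|,\qquad \alpha_n(C)=\alpha(C^n),$$ where $(U,V)$ has distribution function $C$, $\lambda$ is Lebesgue measure and $A,B$ range over the Borel subsets of $[0,1]$. For a process $X=(X_n)_{n\in\mathbb Z}$, put $$\alpha_n(X)=\sup\{|P(A\cap B)-P(A)P(B)| : A\in\sigma(X_i,\ i\le 0),\ B\in\sigma(X_i,\ i\ge n)\};$$ $X$ is $\alpha$-mixing if $\alpha_n(X)\to 0$. A Markov chain $X=(X_n)_{n\in\mathbb Z}$ is generated by $C$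 if every $X_n$ is uniform on $[0,1]$ and every pair $(X_n,X_{n+1})$ has distribution function $C$. A strictly stationary $X$ is ergodic if every shift-invariant event of its trajectory space has probability $0$ or $1$. A Markov chain is aperiodic if for no $d\ge 2$ there are disjoint Borel sets $E_0,\dots,E_{d-1}$ such that, for every $n$, almost surely $X_n\in\bigcup_i E_i$ and, for each $i$, $X_n\in E_i$ implies $X_{n+1}\in E_{i+1 \bmod d}$. **Theorem.** Let $C_1,\dots,C_k$ be copulas, let $a_1,\dots,a_k\in(0,1)$ with $a_1+\dots+a_k=1$, and let $C=a_1C_1+\dots+a_kC_k$. Suppose that for some $s\ge1$ and some indices $k_1,\dots,k_s\in\{1,\dots,k\}$ (repetitions allowed) the copula $\hat C=C_{k_1}*\cdots*C_{k_s}$ satisfies $\alpha(\hat C)<1/4$. Then $\alpha_s(C)<1/4$. Moreover, every strictly stationary Markov chain $X$ generated by $C$ satisfies $\alpha_s(X)<1/4$, and if in addition $X$ is ergodic and aperiodic, then $X$ is $\alpha$-mixing. -/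

import Mathlib

open MeasureTheory ProbabilityTheory Set Filter Topology

/-- A bivariate copula: a function on `[0,1]²` that is grounded, has uniform margins and is
2-increasing. The values outside `[0,1]²` are irrelevant. -/
structure Copula where
  toFun : ℝ → ℝ → ℝ
  zero_left : ∀ x ∈ Icc (0 : ℝ) 1, toFun 0 x = 0
  zero_right : ∀ x ∈ Icc (0 : ℝ) 1, toFun x 0 = 0
  one_left : ∀ x ∈ Icc (0 : ℝ) 1, toFun 1 x = x
  one_right : ∀ x ∈ Icc (0 : ℝ) 1, toFun x 1 = x
  rect_nonneg : ∀ a b c d : ℝ, 0 ≤ a → a ≤ b → b ≤ 1 → 0 ≤ c → c ≤ d → d ≤ 1 →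
    0 ≤ toFun a c + toFun b d - toFun a d - toFun b c

namespace Copula

instance : CoeFun Copula (fun _ => ℝ → ℝ → ℝ) := ⟨toFun⟩

/-- The upper Hoeffding bound `M(u,v) = min(u,v)`. -/
def M : Copula where
  toFun u v := min u v
  zero_left x hx := min_eq_left hx.1
  zero_right x hx := min_eq_right hx.1
  one_left x hx := min_eq_right hx.2
  one_right x hx := min_eq_left hx.2
  rect_nonneg a b c d _ hab _ _ hcd _ := by
    rcases min_cases a c with h | h <;> rcases min_cases b d with h' | h' <;>
      rcases min_cases a d with h'' | h'' <;> rcases min_cases b c with h''' | h''' <;> linarith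

/-- The convex combination `a₁ C₁ + ⋯ + a_k C_k`. -/
def convexComb {k : ℕ} (a : Fin k → ℝ) (C : Fin k → Copula) (ha : ∀ i, 0 ≤ a i)
    (hsum : ∑ i, a i = 1) : Copula where
  toFun u v := ∑ i, a i * C i u v
  zero_left x hx := by simp [(C _).zero_left x hx]
  zero_right x hx := by simp [(C _).zero_right x hx]
  one_left x hx := by simp [(C _).one_left x hx, ← Finset.sum_mul, hsum]
  one_right x hx := by simp [(C _).one_right x hx, ← Finset.sum_mul, hsum]
  rect_nonneg p q r s h1 h2 h3 h4 h5 h6 := by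
    simp only [← Finset.sum_add_distrib, ← Finset.sum_sub_distrib, ← mul_add, ← mul_sub]
    exact Finset.sum_nonneg fun i _ =>
      mul_nonneg (ha i) ((C i).rect_nonneg p q r s h1 h2 h3 h4 h5 h6)

/-- The partial derivative `C_{,1}(x,y)` in the first variable. -/
noncomputable def d1 (C : Copula) (x y : ℝ) : ℝ := deriv (fun s => C s y) x

/-- The partial derivative `C_{,2}(x,y)` in the second variable. -/
noncomputable def d2 (C : Copula) (x y : ℝ) : ℝ := deriv (fun t => C x t) y

/-- The copula `(u,v) ↦ C(v,u)`. -/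
def transpose (C : Copula) : Copula where
  toFun u v := C v u
  zero_left := C.zero_right
  zero_right := C.zero_left
  one_left := C.one_right
  one_right := C.one_left
  rect_nonneg a b c d h1 h2 h3 h4 h5 h6 := by
    linarith [C.rect_nonneg c d a b h4 h5 h6 h1 h2 h3]

lemma d1_transpose (C : Copula) (x y : ℝ) : C.transpose.d1 x y = C.d2 y x := rfl

lemma mono_left (C : Copula) {y y' : ℝ} (hy : 0 ≤ y) (hyy : y ≤ y') (hy' : y' ≤ 1) :
    MonotoneOn (fun s => C s y' - C s y) (Icc 0 1) := by
  intro a ha b hb hab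
  have := C.rect_nonneg a b y y' ha.1 hab hb.2 hy hyy hy'
  simp only
  linarith

lemma lipschitz_left (C : Copula) {y : ℝ} (hy : y ∈ Icc (0 : ℝ) 1) :
    LipschitzOnWith 1 (fun s => C s y) (Icc 0 1) := by
  refine LipschitzOnWith.of_le_add_mul 1 ?_
  intro a ha b hb
  rcases le_total a b with hab | hab
  · have h1 := C.rect_nonneg a b 0 y ha.1 hab hb.2 le_rfl hy.1 hy.2
    rw [C.zero_right a ha, C.zero_right b hb] at h1
    have : 0 ≤ dist a b := dist_nonneg
    simp only [NNReal.coe_one, one_mul]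
    linarith
  · have h1 := C.rect_nonneg b a y 1 hb.1 hab ha.2 hy.1 hy.2 le_rfl
    rw [C.one_right a ha, C.one_right b hb] at h1
    have : dist a b = a - b := by rw [Real.dist_eq, abs_of_nonneg (by linarith)]
    simp only [NNReal.coe_one, one_mul]
    linarith

lemma absCont_left (C : Copula) {y : ℝ} (hy : y ∈ Icc (0 : ℝ) 1) {a b : ℝ}
    (ha : a ∈ Icc (0 : ℝ) 1) (hb : b ∈ Icc (0 : ℝ) 1) :
    AbsolutelyContinuousOnInterval (fun s => C s y) a b :=
  ((C.lipschitz_left hy).mono (uIcc_subset_Icc ha hb)).absolutelyContinuousOnInterval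

lemma integral_d1 (C : Copula) {y : ℝ} (hy : y ∈ Icc (0 : ℝ) 1) {a b : ℝ}
    (ha : a ∈ Icc (0 : ℝ) 1) (hb : b ∈ Icc (0 : ℝ) 1) :
    ∫ x in a..b, C.d1 x y = C b y - C a y :=
  (C.absCont_left hy ha hb).integral_deriv_eq_sub

lemma ae_mem_Ioo : ∀ᵐ x ∂(volume.restrict (Icc (0 : ℝ) 1)), x ∈ Ioo (0 : ℝ) 1 := by
  rw [← restrict_Ioo_eq_restrict_Icc]
  exact ae_restrict_mem measurableSet_Ioo

lemma ae_differentiableAt_left (C : Copula) {y : ℝ} (hy : y ∈ Icc (0 : ℝ) 1) :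
    ∀ᵐ x ∂(volume.restrict (Icc (0 : ℝ) 1)), DifferentiableAt ℝ (fun s => C s y) x := by
  have h := (C.absCont_left hy (a := 0) (b := 1) (by simp) (by simp)).ae_differentiableAt
  rw [uIcc_of_le zero_le_one] at h
  exact (ae_restrict_iff' measurableSet_Icc).2 h

lemma d1_mono (C : Copula) {y y' : ℝ} (hy : 0 ≤ y) (hyy : y ≤ y') (hy' : y' ≤ 1) :
    ∀ᵐ x ∂(volume.restrict (Icc (0 : ℝ) 1)), C.d1 x y ≤ C.d1 x y' := by
  filter_upwards [C.ae_differentiableAt_left ⟨hy, hyy.trans hy'⟩,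
    C.ae_differentiableAt_left ⟨hy.trans hyy, hy'⟩, ae_mem_Ioo] with x h1 h2 hx
  have h3 := ((C.mono_left hy hyy hy').mono Ioo_subset_Icc_self).derivWithin_nonneg (x := x)
  rw [derivWithin_of_isOpen isOpen_Ioo hx] at h3
  have h4 : deriv (fun s => C s y' - C s y) x = C.d1 x y' - C.d1 x y := deriv_fun_sub h2 h1
  linarith

lemma d1_zero (C : Copula) :
    ∀ᵐ x ∂(volume.restrict (Icc (0 : ℝ) 1)), C.d1 x 0 = 0 := by
  filter_upwards [ae_mem_Ioo] with x hx
  have : (fun s => C s 0) =ᶠ[𝓝 x] fun _ => 0 := by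
    filter_upwards [isOpen_Ioo.mem_nhds hx] with s hs
    exact C.zero_right s (Ioo_subset_Icc_self hs)
  rw [d1, this.deriv_eq, deriv_const]

lemma d1_one (C : Copula) :
    ∀ᵐ x ∂(volume.restrict (Icc (0 : ℝ) 1)), C.d1 x 1 = 1 := by
  filter_upwards [ae_mem_Ioo] with x hx
  have : (fun s => C s 1) =ᶠ[𝓝 x] fun s => s := by
    filter_upwards [isOpen_Ioo.mem_nhds hx] with s hs
    exact C.one_right s (Ioo_subset_Icc_self hs)
  rw [d1, this.deriv_eq, deriv_id'']

lemma d1_mem (C : Copula) {y : ℝ} (hy : y ∈ Icc (0 : ℝ) 1) :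
    ∀ᵐ x ∂(volume.restrict (Icc (0 : ℝ) 1)), C.d1 x y ∈ Icc (0 : ℝ) 1 := by
  filter_upwards [C.d1_mono le_rfl hy.1 hy.2, C.d1_mono hy.1 hy.2 le_rfl, C.d1_zero, C.d1_one]
    with x h1 h2 h3 h4
  exact ⟨h3 ▸ h1, h4 ▸ h2⟩

lemma measurable_d1 (C : Copula) (y : ℝ) : Measurable fun x => C.d1 x y := measurable_deriv _

lemma integrable_d1 (C : Copula) {y : ℝ} (hy : y ∈ Icc (0 : ℝ) 1) :
    Integrable (fun x => C.d1 x y) (volume.restrict (Icc (0 : ℝ) 1)) := by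
  refine Integrable.of_bound (C.measurable_d1 y).aestronglyMeasurable 1 ?_
  filter_upwards [C.d1_mem hy] with x hx
  rw [Real.norm_eq_abs, abs_of_nonneg hx.1]
  exact hx.2

lemma integral_Icc_eq (f : ℝ → ℝ) : ∫ x in Icc (0 : ℝ) 1, f x = ∫ x in (0 : ℝ)..1, f x := by
  rw [intervalIntegral.integral_of_le zero_le_one, integral_Icc_eq_integral_Ioc]

lemma integrable_d2_mul_d1 (A B : Copula) {x y : ℝ} (hx : x ∈ Icc (0 : ℝ) 1)
    (hy : y ∈ Icc (0 : ℝ) 1) :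
    Integrable (fun t => A.d2 x t * B.d1 t y) (volume.restrict (Icc (0 : ℝ) 1)) := by
  refine Integrable.of_bound
    ((A.transpose.measurable_d1 x).mul (B.measurable_d1 y)).aestronglyMeasurable 1 ?_
  filter_upwards [A.transpose.d1_mem hx, B.d1_mem hy] with t h1 h2
  rw [d1_transpose] at h1
  rw [Real.norm_eq_abs, abs_of_nonneg (mul_nonneg h1.1 h2.1)]
  exact mul_le_one₀ h1.2 h2.1 h2.2

/-- The fold product `(A * B)(x,y) = ∫₀¹ A_{,2}(x,t) B_{,1}(t,y) dt`. -/
noncomputable def fold (A B : Copula) : Copula where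
  toFun x y := ∫ t in (0 : ℝ)..1, A.d2 x t * B.d1 t y
  zero_left y _ := by
    rw [← integral_Icc_eq]
    refine integral_eq_zero_of_ae ?_
    filter_upwards [A.transpose.d1_zero] with t ht
    rw [d1_transpose] at ht
    simp [ht]
  zero_right x _ := by
    rw [← integral_Icc_eq]
    refine integral_eq_zero_of_ae ?_
    filter_upwards [B.d1_zero] with t ht
    simp [ht]
  one_left y hy := by
    have h := B.integral_d1 hy (a := 0) (b := 1) (by simp) (by simp)
    rw [B.one_left y hy, B.zero_left y hy, sub_zero, ← integral_Icc_eq] at h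
    rw [← integral_Icc_eq]
    refine Eq.trans (integral_congr_ae ?_) h
    filter_upwards [A.transpose.d1_one] with t ht
    rw [d1_transpose] at ht
    simp [ht]
  one_right x hx := by
    have h := A.transpose.integral_d1 hx (a := 0) (b := 1) (by simp) (by simp)
    rw [A.transpose.one_left x hx, A.transpose.zero_left x hx, sub_zero, ← integral_Icc_eq] at h
    rw [← integral_Icc_eq]
    refine Eq.trans (integral_congr_ae ?_) h
    filter_upwards [B.d1_one] with t ht
    rw [d1_transpose]
    simp [ht]
  rect_nonneg a b c d ha hab hb hc hcd hd := by
    have ha' : a ∈ Icc (0 : ℝ) 1 := ⟨ha, hab.trans hb⟩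
    have hb' : b ∈ Icc (0 : ℝ) 1 := ⟨ha.trans hab, hb⟩
    have hc' : c ∈ Icc (0 : ℝ) 1 := ⟨hc, hcd.trans hd⟩
    have hd' : d ∈ Icc (0 : ℝ) 1 := ⟨hc.trans hcd, hd⟩
    simp only [← integral_Icc_eq]
    have h : 0 ≤ ∫ t in Icc (0 : ℝ) 1, (A.d2 a t * B.d1 t c + A.d2 b t * B.d1 t d
        - A.d2 a t * B.d1 t d - A.d2 b t * B.d1 t c) := by
      refine integral_nonneg_of_ae ?_
      filter_upwards [A.transpose.d1_mono ha hab hb, B.d1_mono hc hcd hd] with t h1 h2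
      rw [d1_transpose, d1_transpose] at h1
      have := mul_nonneg (sub_nonneg.2 h1) (sub_nonneg.2 h2)
      simp only [Pi.zero_apply]
      linarith
    have i1 := A.integrable_d2_mul_d1 B ha' hc'
    have i2 := A.integrable_d2_mul_d1 B hb' hd'
    have i3 := A.integrable_d2_mul_d1 B ha' hd'
    have i4 := A.integrable_d2_mul_d1 B hb' hc'
    have i12 : Integrable (fun t => A.d2 a t * B.d1 t c + A.d2 b t * B.d1 t d)
        (volume.restrict (Icc (0 : ℝ) 1)) := i1.add i2
    have i123 : Integrable (fun t => A.d2 a t * B.d1 t c + A.d2 b t * B.d1 t d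
        - A.d2 a t * B.d1 t d) (volume.restrict (Icc (0 : ℝ) 1)) := i12.sub i3
    rw [integral_sub i123 i4, integral_sub i12 i3, integral_add i1 i2] at h
    exact h

/-- The fold product `D₀ * D₁ * ⋯ * D_{n-1}`, associated to the left. The product of a single
copula is that copula; the empty product is by convention the unit `M`. -/
noncomputable def foldProd : (n : ℕ) → (Fin n → Copula) → Copula
  | 0, _ => M
  | 1, D => D 0
  | n + 2, D => fold (foldProd (n + 1) fun i => D i.castSucc) (D (Fin.last (n + 1)))

/-- The `n`-fold product `Cⁿ`: `C¹ = C` and `Cⁿ = Cⁿ⁻¹ * C` for `n > 1`. -/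
noncomputable def foldPow (C : Copula) (n : ℕ) : Copula := foldProd n fun _ => C

/-- The rational conditional distribution functions `q ↦ C_{,1}(x, q)`, extended to all of `ℚ`
by clamping `q` to `[0,1]`. -/
noncomputable def condRat (C : Copula) (x : ℝ) (q : ℚ) : ℝ := C.d1 x (max 0 (min 1 (q : ℝ)))

lemma measurable_condRat (C : Copula) : Measurable C.condRat :=
  measurable_pi_lambda _ fun _ => C.measurable_d1 _

/-- The transition kernel `x ↦ P(Y ∈ · | X = x)` of the copula: the probability measure on `ℝ`
whose distribution function is `y ↦ C_{,1}(x,y)` (for almost every `x`). -/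
noncomputable def kernel (C : Copula) : Kernel ℝ ℝ where
  toFun x := (stieltjesOfMeasurableRat C.condRat C.measurable_condRat x).measure
  measurable' := measurable_measure_stieltjesOfMeasurableRat C.measurable_condRat

instance (C : Copula) : IsMarkovKernel C.kernel :=
  ⟨fun x => instIsProbabilityMeasure_stieltjesOfMeasurableRat C.measurable_condRat x⟩

/-- The law on `ℝ²` of a random vector `(U,V)` with distribution function `C`: `U` is uniform on
`[0,1]` and `P(V ≤ v | U = u) = C_{,1}(u,v)`. See `Copula.measure_Iic_prod_Iic`. -/
noncomputable def measure (C : Copula) : Measure (ℝ × ℝ) :=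
  (volume.restrict (Icc (0 : ℝ) 1)) ⊗ₘ C.kernel

instance isProbabilityMeasure_unif :
    IsProbabilityMeasure ((volume : Measure ℝ).restrict (Icc (0 : ℝ) 1)) := ⟨by simp⟩

instance (C : Copula) : IsProbabilityMeasure C.measure := by
  unfold measure; infer_instance

lemma clamp_mem (q : ℝ) : max 0 (min 1 q) ∈ Icc (0 : ℝ) 1 :=
  ⟨le_max_left _ _, max_le zero_le_one (min_le_left _ _)⟩

lemma ae_isRatStieltjesPoint (C : Copula) :
    ∀ᵐ x ∂(volume.restrict (Icc (0 : ℝ) 1)), IsRatStieltjesPoint C.condRat x := by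
  have hmono : ∀ᵐ x ∂(volume.restrict (Icc (0 : ℝ) 1)), Monotone (C.condRat x) := by
    have : ∀ᵐ x ∂(volume.restrict (Icc (0 : ℝ) 1)), ∀ q r : ℚ, q ≤ r →
        C.condRat x q ≤ C.condRat x r := by
      simp only [ae_all_iff]
      intro q r hqr
      have hqr' : (q : ℝ) ≤ r := by exact_mod_cast hqr
      exact C.d1_mono (clamp_mem _).1 (max_le_max le_rfl (min_le_min le_rfl hqr')) (clamp_mem _).2
    filter_upwards [this] with x hx q r hqr using hx q r hqr
  have hbound : ∀ᵐ x ∂(volume.restrict (Icc (0 : ℝ) 1)), ∀ q : ℚ,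
      C.condRat x q ∈ Icc (0 : ℝ) 1 := by
    rw [ae_all_iff]
    exact fun q => C.d1_mem (clamp_mem _)
  have hinf : ∀ᵐ x ∂(volume.restrict (Icc (0 : ℝ) 1)), ∀ t : ℚ,
      ⨅ r : Ioi t, C.condRat x r = C.condRat x t := by
    rw [ae_all_iff]
    intro t
    set g : ℝ → ℝ := fun x => (⨅ r : Ioi t, C.condRat x r) - C.condRat x t with hg
    have hgm : Measurable g :=
      (Measurable.iInf fun r => C.measurable_d1 _).sub (C.measurable_d1 _)
    have hle : ∀ᵐ x ∂(volume.restrict (Icc (0 : ℝ) 1)), 0 ≤ g x ∧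
        ∀ r : ℚ, t < r → g x ≤ C.condRat x r - C.condRat x t := by
      filter_upwards [hmono, hbound] with x hx hb
      refine ⟨sub_nonneg.2 (le_ciInf fun r => hx (le_of_lt r.2)), fun r hr => ?_⟩
      refine sub_le_sub_right ?_ _
      refine ciInf_le (f := fun r : Ioi t => C.condRat x r) ⟨0, ?_⟩ ⟨r, hr⟩
      rintro _ ⟨s, rfl⟩
      exact (hb s).1
    have hint : ∀ q : ℚ, Integrable (fun x => C.condRat x q)
        (volume.restrict (Icc (0 : ℝ) 1)) := fun q => C.integrable_d1 (clamp_mem _)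
    have hval : ∀ q : ℚ, ∫ x in Icc (0 : ℝ) 1, C.condRat x q = max 0 (min 1 (q : ℝ)) := by
      intro q
      rw [integral_Icc_eq]
      have := C.integral_d1 (clamp_mem (q : ℝ)) (a := 0) (b := 1) (by simp) (by simp)
      rw [C.one_left _ (clamp_mem _), C.zero_left _ (clamp_mem _), sub_zero] at this
      exact this
    have hgi : Integrable g (volume.restrict (Icc (0 : ℝ) 1)) := by
      obtain ⟨r, hr⟩ := exists_gt t
      refine ((hint r).sub (hint t)).mono' hgm.aestronglyMeasurable ?_
      filter_upwards [hle] with x hx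
      rw [Real.norm_eq_abs, abs_of_nonneg hx.1]
      exact hx.2 r hr
    have hg0 : ∫ x in Icc (0 : ℝ) 1, g x ≤ 0 := by
      refine le_of_forall_pos_le_add fun ε hε => ?_
      obtain ⟨r, hr1, hr2⟩ := exists_rat_btwn (show (t : ℝ) < t + ε by linarith)
      have h1 : ∫ x in Icc (0 : ℝ) 1, g x ≤
          ∫ x in Icc (0 : ℝ) 1, (C.condRat x r - C.condRat x t) := by
        refine integral_mono_ae hgi ((hint r).sub (hint t)) ?_
        filter_upwards [hle] with x hx using hx.2 r (by exact_mod_cast hr1)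
      rw [integral_sub (hint r) (hint t), hval, hval] at h1
      have h2 : max 0 (min 1 (r : ℝ)) - max 0 (min 1 (t : ℝ)) ≤ r - t := by
        rcases max_cases 0 (min 1 (r : ℝ)) with h | h <;>
          rcases max_cases 0 (min 1 (t : ℝ)) with h' | h' <;>
          rcases min_cases 1 (r : ℝ) with h'' | h'' <;>
          rcases min_cases 1 (t : ℝ) with h''' | h''' <;> linarith
      linarith
    have hnn : 0 ≤ᵐ[volume.restrict (Icc (0 : ℝ) 1)] g := by
      filter_upwards [hle] with x hx using hx.1
    have h0 := (integral_eq_zero_iff_of_nonneg_ae hnn hgi).1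
      (le_antisymm hg0 (integral_nonneg_of_ae hnn))
    filter_upwards [h0] with x hx
    exact sub_eq_zero.1 hx
  filter_upwards [hmono, hinf, C.d1_zero, C.d1_one] with x h1 h2 h3 h4
  refine ⟨h1, ?_, ?_, h2⟩
  · refine tendsto_const_nhds.congr' ?_
    filter_upwards [eventually_ge_atTop 1] with q hq
    have : (1 : ℝ) ≤ q := by exact_mod_cast hq
    rw [condRat, min_eq_left this, max_eq_right zero_le_one, h4]
  · refine tendsto_const_nhds.congr' ?_
    filter_upwards [eventually_le_atBot 0] with q hq
    have : (q : ℝ) ≤ 0 := by exact_mod_cast hq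
    rw [condRat, min_eq_right (this.trans zero_le_one), max_eq_left this, h3]

lemma measure_Iic_prod_Iic_rat (C : Copula) {u : ℝ} (hu : u ∈ Icc (0 : ℝ) 1) (q : ℚ) :
    C.measure.real (Iic u ×ˢ Iic (q : ℝ)) = C u (max 0 (min 1 (q : ℝ))) := by
  have h1 : C.measure (Iic u ×ˢ Iic (q : ℝ)) = ENNReal.ofReal (C u (max 0 (min 1 (q : ℝ)))) := by
    rw [measure, Measure.compProd_apply_prod measurableSet_Iic measurableSet_Iic,
      Measure.restrict_restrict measurableSet_Iic]
    have hs : Iic u ∩ Icc (0 : ℝ) 1 = Icc 0 u := by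
      ext z; simp only [mem_inter_iff, mem_Iic, mem_Icc]
      exact ⟨fun h => ⟨h.2.1, h.1⟩, fun h => ⟨h.2, h.1, h.2.trans hu.2⟩⟩
    rw [hs]
    have hsub : (volume.restrict (Icc (0 : ℝ) u)) ≤ volume.restrict (Icc (0 : ℝ) 1) :=
      Measure.restrict_mono (Icc_subset_Icc le_rfl hu.2) le_rfl
    have h2 : ∫⁻ x in Icc (0 : ℝ) u, C.kernel x (Iic (q : ℝ)) =
        ∫⁻ x in Icc (0 : ℝ) u, ENNReal.ofReal (C.condRat x q) := by
      refine lintegral_congr_ae ?_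
      filter_upwards [ae_mono hsub C.ae_isRatStieltjesPoint] with x hx
      change (stieltjesOfMeasurableRat C.condRat C.measurable_condRat x).measure _ = _
      rw [measure_stieltjesOfMeasurableRat_Iic, stieltjesOfMeasurableRat_eq,
        toRatCDF_of_isRatStieltjesPoint hx]
    rw [h2, ← ofReal_integral_eq_lintegral_ofReal]
    · congr 1
      rw [integral_Icc_eq_integral_Ioc, ← intervalIntegral.integral_of_le hu.1]
      have := C.integral_d1 (clamp_mem (q : ℝ)) (a := 0) (b := u) (by simp) hu
      rw [C.zero_left _ (clamp_mem _), sub_zero] at this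
      exact this
    · exact (C.integrable_d1 (clamp_mem _)).mono_measure hsub
    · filter_upwards [ae_mono hsub (C.d1_mem (clamp_mem (q : ℝ)))] with x hx using hx.1
  have hnn : 0 ≤ C u (max 0 (min 1 (q : ℝ))) := by
    have hq := clamp_mem (q : ℝ)
    have := C.rect_nonneg 0 u 0 _ le_rfl hu.1 hu.2 le_rfl hq.1 hq.2
    rw [C.zero_left 0 (by simp), C.zero_left _ hq, C.zero_right u hu] at this
    linarith
  rw [measureReal_def, h1, ENNReal.toReal_ofReal hnn]

/-- The distribution function of `C.measure` is `C`. -/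
theorem measure_Iic_prod_Iic (C : Copula) {u v : ℝ} (hu : u ∈ Icc (0 : ℝ) 1)
    (hv : v ∈ Icc (0 : ℝ) 1) : C.measure.real (Iic u ×ˢ Iic v) = C u v := by
  have hclamp : ∀ w ∈ Icc (0 : ℝ) 1, max 0 (min 1 w) = w := fun w hw => by
    rw [min_eq_right hw.2, max_eq_right hw.1]
  have hlip : ∀ q : ℝ, |C u (max 0 (min 1 q)) - C u v| ≤ |q - v| := by
    intro q
    have h := (C.transpose.lipschitz_left hu).dist_le_mul _ (clamp_mem q) v hv
    rw [Real.dist_eq, Real.dist_eq, NNReal.coe_one, one_mul] at h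
    refine h.trans ?_
    have h1 : |max 0 (min 1 q) - max 0 (min 1 v)| ≤ |min 1 q - min 1 v| := by
      rw [max_comm 0, max_comm 0]; exact abs_max_sub_max_le_abs _ _ _
    have h2 : |min 1 q - min 1 v| ≤ |q - v| := by
      have := abs_min_sub_min_le_max 1 q 1 v
      simpa using this
    rw [hclamp v hv] at h1
    exact h1.trans h2
  refine le_antisymm ?_ ?_
  · refine le_of_forall_pos_le_add fun ε hε => ?_
    obtain ⟨r, hr1, hr2⟩ := exists_rat_btwn (show v < v + ε by linarith)
    have h1 : C.measure.real (Iic u ×ˢ Iic v) ≤ C.measure.real (Iic u ×ˢ Iic (r : ℝ)) :=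
      measureReal_mono (prod_mono le_rfl (Iic_subset_Iic.2 hr1.le))
    rw [C.measure_Iic_prod_Iic_rat hu] at h1
    have h2 := (abs_le.1 (hlip r)).2
    rw [abs_of_nonneg (by linarith)] at h2
    linarith
  · refine le_of_forall_pos_le_add fun ε hε => ?_
    obtain ⟨r, hr1, hr2⟩ := exists_rat_btwn (show v - ε < v by linarith)
    have h1 : C.measure.real (Iic u ×ˢ Iic (r : ℝ)) ≤ C.measure.real (Iic u ×ˢ Iic v) :=
      measureReal_mono (prod_mono le_rfl (Iic_subset_Iic.2 hr2.le))
    rw [C.measure_Iic_prod_Iic_rat hu] at h1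
    have h2 := (abs_le.1 (hlip r)).1
    rw [abs_of_neg (by linarith)] at h2
    linarith

end Copula

/-- The strong mixing coefficient `α(𝒜,ℬ) = sup |P(A ∩ B) - P(A)P(B)|` over `A ∈ 𝒜`, `B ∈ ℬ`. -/
noncomputable def strongMixingCoeff {Ω : Type*} [MeasurableSpace Ω] (P : Measure Ω)
    (𝒜 ℬ : MeasurableSpace Ω) : ℝ :=
  sSup {r : ℝ | ∃ A B : Set Ω, MeasurableSet[𝒜] A ∧ MeasurableSet[ℬ] B ∧
    r = |P.real (A ∩ B) - P.real A * P.real B|}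

namespace Copula

/-- `α(C)`: the supremum over Borel sets `A, B ⊆ [0,1]` of `|P(U ∈ A, V ∈ B) - λ(A)λ(B)|`, where
`(U,V)` has distribution function `C` and `λ` is Lebesgue measure. If `C` has a density `c`, this
is `sup |∫_A ∫_B (c(x,y) - 1) dy dx|`. -/
noncomputable def alpha (C : Copula) : ℝ :=
  sSup {r : ℝ | ∃ A B : Set ℝ, MeasurableSet A ∧ MeasurableSet B ∧
    A ⊆ Icc 0 1 ∧ B ⊆ Icc 0 1 ∧
    r = |C.measure.real (A ×ˢ B) - (volume : Measure ℝ).real A * (volume : Measure ℝ).real B|}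

/-- `α_n(C) = α(Cⁿ)`, the `n`-th strong mixing coefficient of the copula `C`. -/
noncomputable def alphaN (C : Copula) (n : ℕ) : ℝ := (C.foldPow n).alpha

end Copula

section Chains

variable {Ω : Type*} [MeasurableSpace Ω]

/-- The σ-algebra generated by the variables `X i` with `i ∈ T`. -/
abbrev sigmaOf (X : ℤ → Ω → ℝ) (T : Set ℤ) : MeasurableSpace Ω :=
  ⨆ i ∈ T, MeasurableSpace.comap (X i) inferInstance

/-- The process `X` is a Markov chain: given the past up to time `n`, the conditional distribution
of `X (n+1)` depends on `X n` only. -/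
structure IsMarkovChain (X : ℤ → Ω → ℝ) (P : Measure Ω) : Prop where
  measurable : ∀ n, Measurable (X n)
  markov : ∀ (n : ℤ) (B : Set ℝ), MeasurableSet B →
    P⟦X (n + 1) ⁻¹' B | sigmaOf X (Iic n)⟧ =ᵐ[P] P⟦X (n + 1) ⁻¹' B | sigmaOf X {n}⟧

/-- The Markov chain `X` is generated by the copula `C`: it is a Markov chain, its variables are
uniform on `[0,1]`, and `C` is the joint distribution function of any two consecutive variables. -/
structure IsGeneratedByCopula (X : ℤ → Ω → ℝ) (P : Measure Ω) (C : Copula) : Prop where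
  isMarkovChain : IsMarkovChain X P
  uniform : ∀ n, P.map (X n) = (volume : Measure ℝ).restrict (Icc 0 1)
  joint : ∀ n, ∀ u ∈ Icc (0 : ℝ) 1, ∀ v ∈ Icc (0 : ℝ) 1,
    P.real {ω | X n ω ≤ u ∧ X (n + 1) ω ≤ v} = C u v

/-- The law on `ℝ^ℤ` of the whole trajectory. -/
noncomputable def pathLaw (X : ℤ → Ω → ℝ) (P : Measure Ω) : Measure (ℤ → ℝ) :=
  P.map fun ω i => X i ω

/-- The shift on two-sided real sequences. -/
def seqShift (x : ℤ → ℝ) : ℤ → ℝ := fun i => x (i + 1)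

/-- Strict stationarity: the law of the trajectory is invariant under the shift. -/
def IsStrictlyStationary (X : ℤ → Ω → ℝ) (P : Measure Ω) : Prop :=
  MeasurePreserving seqShift (pathLaw X P) (pathLaw X P)

/-- Ergodicity of a strictly stationary process: shift-invariant events of the trajectory space
have probability `0` or `1`. -/
def IsErgodicProcess (X : ℤ → Ω → ℝ) (P : Measure Ω) : Prop :=
  Ergodic seqShift (pathLaw X P)

/-- `X` has a cycle of length `d`: there are disjoint Borel sets `E 0, …, E (d-1)` which contain
the state almost surely and which the chain visits in cyclic order, almost surely. -/
def HasCycle (X : ℤ → Ω → ℝ) (P : Measure Ω) (d : ℕ) : Prop :=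
  ∃ E : ZMod d → Set ℝ, (∀ i, MeasurableSet (E i)) ∧ Pairwise (fun i j => Disjoint (E i) (E j)) ∧
    (∀ n, ∀ᵐ ω ∂P, ∃ i, X n ω ∈ E i) ∧
    ∀ n i, ∀ᵐ ω ∂P, X n ω ∈ E i → X (n + 1) ω ∈ E (i + 1)

/-- Aperiodicity: there is no cycle of length at least two. -/
def IsAperiodicChain (X : ℤ → Ω → ℝ) (P : Measure Ω) : Prop :=
  ∀ d : ℕ, 2 ≤ d → ¬ HasCycle X P d

/-- `α_n` of a process: the strong mixing coefficient between `σ(X_i, i ≤ 0)` and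
`σ(X_i, i ≥ n)`. -/
noncomputable def processAlpha (X : ℤ → Ω → ℝ) (P : Measure Ω) (n : ℕ) : ℝ :=
  strongMixingCoeff P (sigmaOf X (Iic 0)) (sigmaOf X (Ici (n : ℤ)))

/-- The process is `α`-mixing: `α_n → 0`. -/
def IsAlphaMixing (X : ℤ → Ω → ℝ) (P : Measure Ω) : Prop :=
  Tendsto (processAlpha X P) atTop (𝓝 0)

end Chains

/-!
The first assertion is a convexity argument. For sets `A, B` of any probability space,
`|P(A ∩ B) - P(A) P(B)| ≤ 1/4`, so `α` never exceeds `1/4`; moreover `α` is convex. The fold product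
is bilinear and positive, hence `C ^ s` gives every rectangle at least `w = a_{k₁} ⋯ a_{k_s}` times
the mass that `Ĉ` gives it (`Copula.dominates_foldProd`), and what remains is `1 - w` times a copula.
Therefore `α(C ^ s) ≤ w α(Ĉ) + (1 - w) / 4 < 1/4` (`Copula.alpha_le_of_dominates`).

For a chain `X` generated by `C`, past and future are conditionally independent given the present
(`IsMarkovChain.measureReal_inter_eq`), so the dependence between `σ(X_i, i ≤ 0)` and
`σ(X_i, i ≥ n)` is realized by the pair `(X_0, X_n)`, whose law belongs to the copula `C ^ n`
(`IsGeneratedByCopula.measureReal_inter_eq_measure`). This yields `α_n(X) ≤ α_n(C)`.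

It remains to see that `α_s(C) < 1/4` forces mixing when `X` is ergodic and aperiodic. Call a set of
states `A` nearly deterministic at time `n` if `X_n ∈ A` is, up to small probability, an event of
`X_0`. A set of measure near `1/2` that is nearly deterministic at time `s` would give `α_s(C)` near
`1/4`, so there is none. Mixing follows in two steps.

* Sets that are exactly deterministic at all times form a `σ`-algebra on which the chain acts. If it
  contained sets of arbitrarily small positive measure, then by ergodicity the unions of the images
  of such a set would grow in small steps to full measure, passing near `1/2`. So it has an atom,
  whose images are permuted cyclically and exhaust the space; by aperiodicity the atom is the whole
  space, and the `σ`-algebra is trivial (`IsStationaryMarkov.deterministic_trivial`).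
* If `α_n` did not tend to `0`, there would be centred `f` with `|f| ≤ 1` for which `‖T ^ n f‖₂` is
  bounded below for arbitrarily large `n`, where `T` is the transition operator on `L²`. The norms
  decrease, so on some long stretch they are almost constant, and there a superlevel set of the
  iterate is nearly deterministic at a large time, with measure bounded away from `0` and `1`
  (`IsStationaryMarkov.exists_nearDet_of_correlation`). Along an ultrafilter the indicators of these
  sets `A_m` converge weakly to some `h` with `‖T ^ n h‖ = ‖h‖` for all `n`; its level sets are
  deterministic, hence trivial, so `h` is a constant `p` in `(0, 1)`. Thus `A_m` is asymptotically
  independent of every fixed set (`IsStationaryMarkov.exists_asymptotically_independent`), and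
  bisecting with the sets `A_m` leads to nearly deterministic sets of measure near `1/2`
  (`exists_nearDet_half`), a contradiction.
-/

set_option linter.unusedSectionVars false

/-! ### The transition operators of a stationary chain on `L²` -/

section Transition

open scoped RealInnerProductSpace

variable {Ω S : Type*} [MeasurableSpace Ω] [MeasurableSpace S]

/-- The indicator of a measurable set as a vector of `L²`. -/
noncomputable def ind (π : Measure S) [IsFiniteMeasure π] {A : Set S} (hA : MeasurableSet A) :
    Lp ℝ 2 π := indicatorConstLp 2 hA (measure_ne_top π A) 1

lemma inner_ind_left (π : Measure S) [IsFiniteMeasure π] {A : Set S} (hA : MeasurableSet A)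
    (f : Lp ℝ 2 π) : ⟪ind π hA, f⟫ = ∫ x in A, f x ∂π :=
  L2.inner_indicatorConstLp_one hA _ f

lemma inner_ind_ind (π : Measure S) [IsFiniteMeasure π] {A B : Set S} (hA : MeasurableSet A)
    (hB : MeasurableSet B) : ⟪ind π hA, ind π hB⟫ = π.real (A ∩ B) :=
  L2.real_inner_indicatorConstLp_one_indicatorConstLp_one hA hB

lemma coeFn_ind (π : Measure S) [IsFiniteMeasure π] {A : Set S} (hA : MeasurableSet A) :
    ind π hA =ᵐ[π] A.indicator fun _ => (1 : ℝ) := indicatorConstLp_coeFn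

/-- Two bounded operators on `L²` that agree on indicators are equal. -/
lemma clm_ext_ind {π : Measure S} [IsFiniteMeasure π] {E : Type*} [NormedAddCommGroup E]
    [NormedSpace ℝ E] {T T' : Lp ℝ 2 π →L[ℝ] E}
    (h : ∀ (A : Set S) (hA : MeasurableSet A), T (ind π hA) = T' (ind π hA)) : T = T' := by
  ext1 f
  refine Lp.induction (by simp) (fun f => T f = T' f) ?_ ?_ ?_ f
  · intro c A hA hπ
    have : (Lp.simpleFunc.indicatorConst 2 hA hπ.ne c : Lp ℝ 2 π) = c • ind π hA := by
      rw [Lp.simpleFunc.coe_indicatorConst]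
      ext1
      filter_upwards [indicatorConstLp_coeFn (p := 2) (hs := hA) (hμs := hπ.ne) (c := c),
        Lp.coeFn_smul c (ind π hA), coeFn_ind π hA] with x h1 h2 h3
      rw [h1, h2, Pi.smul_apply, h3]
      by_cases hx : x ∈ A <;> simp [hx]
    rw [this, map_smul, map_smul, h]
  · intro f g hf hg _ h1 h2
    rw [map_add, map_add, h1, h2]
  · exact isClosed_eq T.continuous T'.continuous

variable {P : Measure Ω} [IsProbabilityMeasure P] {π : Measure S} [IsProbabilityMeasure π]
  {X : ℤ → Ω → S}

/-- The properties of a strictly stationary Markov chain with marginal law `π` on which its mixing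
behaviour rests: the laws of pairs are shift invariant, and `X m` and `X (n + 1)` are conditionally
independent given `X n` whenever `m ≤ n`. -/
structure IsStationaryMarkov (X : ℤ → Ω → S) (P : Measure Ω) (π : Measure S) : Prop where
  measurePreserving : ∀ n, MeasurePreserving (X n) P π
  shift : ∀ (m n : ℤ) (A B : Set S), MeasurableSet A → MeasurableSet B →
    P (X (m + 1) ⁻¹' A ∩ X (n + 1) ⁻¹' B) = P (X m ⁻¹' A ∩ X n ⁻¹' B)
  markov : ∀ (m n : ℤ) (A B : Set S), m ≤ n → MeasurableSet A → MeasurableSet B →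
    P.real (X m ⁻¹' A ∩ X (n + 1) ⁻¹' B) =
      ∫ ω, (P⟦X m ⁻¹' A | MeasurableSpace.comap (X n) inferInstance⟧) ω *
        (P⟦X (n + 1) ⁻¹' B | MeasurableSpace.comap (X n) inferInstance⟧) ω ∂P

namespace IsStationaryMarkov

variable (hX : IsStationaryMarkov X P π)

/-- The isometry `f ↦ f (X n)` from `L²(π)` to `L²(P)`. -/
noncomputable def lift (n : ℤ) : Lp ℝ 2 π →L[ℝ] Lp ℝ 2 P :=
  (Lp.compMeasurePreservingₗᵢ ℝ (X n) (hX.measurePreserving n)).toContinuousLinearMap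

lemma norm_lift (n : ℤ) (f : Lp ℝ 2 π) : ‖hX.lift n f‖ = ‖f‖ :=
  (Lp.compMeasurePreservingₗᵢ ℝ (X n) (hX.measurePreserving n)).norm_map f

lemma inner_lift_lift (n : ℤ) (f g : Lp ℝ 2 π) : ⟪hX.lift n f, hX.lift n g⟫ = ⟪f, g⟫ :=
  (Lp.compMeasurePreservingₗᵢ ℝ (X n) (hX.measurePreserving n)).inner_map_map f g

lemma coeFn_lift (n : ℤ) (f : Lp ℝ 2 π) : hX.lift n f =ᵐ[P] fun ω => f (X n ω) :=
  Lp.coeFn_compMeasurePreserving f (hX.measurePreserving n)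

lemma lift_ind (n : ℤ) {A : Set S} (hA : MeasurableSet A) :
    hX.lift n (ind π hA) = ind P ((hX.measurePreserving n).measurable hA) :=
  Lp.indicatorConstLp_compMeasurePreserving hA (measure_ne_top π A) 1 (hX.measurePreserving n)

/-- The operator `f ↦ 𝔼[f (X n) | X m = ·]` on `L²(π)`. -/
noncomputable def trans (m n : ℤ) : Lp ℝ 2 π →L[ℝ] Lp ℝ 2 π :=
  (ContinuousLinearMap.adjoint (hX.lift m)).comp (hX.lift n)

lemma inner_trans (m n : ℤ) (f g : Lp ℝ 2 π) :
    ⟪hX.trans m n f, g⟫ = ⟪hX.lift n f, hX.lift m g⟫ := by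
  simp [trans, ContinuousLinearMap.adjoint_inner_left]

lemma inner_trans_ind (m n : ℤ) {A B : Set S} (hA : MeasurableSet A) (hB : MeasurableSet B) :
    ⟪hX.trans m n (ind π hA), ind π hB⟫ = P.real (X n ⁻¹' A ∩ X m ⁻¹' B) := by
  rw [inner_trans, lift_ind, lift_ind, inner_ind_ind]

lemma ext_inner_ind {f g : Lp ℝ 2 π}
    (h : ∀ (A : Set S) (hA : MeasurableSet A), ⟪f, ind π hA⟫ = ⟪g, ind π hA⟫) : f = g := by
  have : innerSL ℝ f = innerSL ℝ g := clm_ext_ind (by simpa using h)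
  refine ext_inner_right ℝ fun v => ?_
  simpa using DFunLike.congr_fun this v

lemma trans_self (n : ℤ) (f : Lp ℝ 2 π) : hX.trans n n f = f :=
  ext_inner_right ℝ fun g => by rw [inner_trans, inner_lift_lift]

lemma trans_add_one (m n : ℤ) : hX.trans (m + 1) (n + 1) = hX.trans m n := by
  refine clm_ext_ind fun A hA => ext_inner_ind fun B hB => ?_
  rw [inner_trans_ind, inner_trans_ind, measureReal_def, hX.shift n m A B hA hB, measureReal_def]

lemma trans_add_nat (m n : ℤ) (k : ℕ) : hX.trans (m + k) (n + k) = hX.trans m n := by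
  induction k with
  | zero => simp
  | succ k ih =>
    push_cast
    rw [← add_assoc, ← add_assoc, trans_add_one, ih]

/-- The composition of `trans n k` with the isometry `lift n` is the conditional expectation given
`X n`. -/
lemma condExp_eq (n k : ℤ) {A : Set S} (hA : MeasurableSet A) :
    P⟦X k ⁻¹' A | MeasurableSpace.comap (X n) inferInstance⟧ =ᵐ[P]
      hX.lift n (hX.trans n k (ind π hA)) := by
  have hm : MeasurableSpace.comap (X n) inferInstance ≤ (inferInstance : MeasurableSpace Ω) :=
    (hX.measurePreserving n).measurable.comap_le
  have hL : ∀ f : Lp ℝ 2 P, Integrable f P := fun f => (Lp.memLp f).integrable (by norm_num)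
  symm
  refine ae_eq_condExp_of_forall_setIntegral_eq hm ?_ (fun _ _ _ => (hL _).integrableOn) ?_ ?_
  · exact (integrable_const (1 : ℝ)).indicator ((hX.measurePreserving k).measurable hA)
  · rintro _ ⟨B, hB, rfl⟩ _
    have hB' := (hX.measurePreserving n).measurable hB
    rw [← inner_ind_left P hB', ← hX.lift_ind n hB, inner_lift_lift, real_inner_comm,
      inner_trans, real_inner_comm, lift_ind, inner_ind_left, lift_ind]
    refine integral_congr_ae (ae_restrict_of_ae ?_)
    exact coeFn_ind P _
  · refine AEStronglyMeasurable.congr ?_ (hX.coeFn_lift n _).symm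
    refine (Measurable.aestronglyMeasurable ?_)
    exact (Lp.stronglyMeasurable _).measurable.comp (comap_measurable _)

lemma trans_succ (m n : ℤ) (hmn : m ≤ n) :
    hX.trans m (n + 1) = (hX.trans m n).comp (hX.trans n (n + 1)) := by
  refine clm_ext_ind fun B hB => ext_inner_ind fun A hA => ?_
  rw [inner_trans_ind, inter_comm, hX.markov m n A B hmn hA hB, ContinuousLinearMap.comp_apply,
    inner_trans, real_inner_comm, ← inner_trans, ← hX.inner_lift_lift n, L2.inner_def]
  refine integral_congr_ae ?_
  filter_upwards [hX.condExp_eq n m hA, hX.condExp_eq n (n + 1) hB] with ω h1 h2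
  rw [h1, h2, real_inner_eq_re_inner, mul_comm]
  rfl

lemma norm_trans_le (m n : ℤ) (f : Lp ℝ 2 π) : ‖hX.trans m n f‖ ≤ ‖f‖ := by
  have h := hX.inner_trans m n f (hX.trans m n f)
  have h' := real_inner_le_norm (hX.lift n f) (hX.lift m (hX.trans m n f))
  rw [← h, real_inner_self_eq_norm_sq, norm_lift, norm_lift] at h'
  nlinarith [norm_nonneg (hX.trans m n f), norm_nonneg f]

/-- The mean squared error of the best prediction of `f (X n)` from `X m`. -/
lemma norm_lift_sub_sq (m n : ℤ) (f : Lp ℝ 2 π) :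
    ‖hX.lift n f - hX.lift m (hX.trans m n f)‖ ^ 2 = ‖f‖ ^ 2 - ‖hX.trans m n f‖ ^ 2 := by
  rw [norm_sub_sq_real, ← inner_trans, real_inner_self_eq_norm_sq, norm_lift, norm_lift]
  ring

lemma norm_sq_sub_le (m n : ℤ) (f g : Lp ℝ 2 π) :
    ‖f‖ ^ 2 - ‖hX.trans m n f‖ ^ 2 ≤ ‖hX.lift n f - hX.lift m g‖ ^ 2 := by
  have h : 0 ≤ ‖hX.trans m n f - g‖ ^ 2 := by positivity
  rw [norm_sub_sq_real] at h ⊢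
  rw [← inner_trans, norm_lift, norm_lift]
  linarith

lemma trans_comp (m n : ℕ) :
    hX.trans 0 (m + n : ℕ) = (hX.trans 0 m).comp (hX.trans 0 n) := by
  have h : ∀ n : ℕ, hX.trans 0 (m + n : ℕ) = (hX.trans 0 m).comp (hX.trans m (m + n : ℕ)) := by
    intro n
    induction n with
    | zero => ext1 f; simp [trans_self]
    | succ n ih =>
      have h1 := hX.trans_succ 0 (m + n : ℕ) (by positivity)
      have h2 := hX.trans_succ m (m + n : ℕ) (by push_cast; linarith)
      have h3 : ((m + (n + 1) : ℕ) : ℤ) = (m + n : ℕ) + 1 := by push_cast; ring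
      rw [h3, h1, h2, ih, ContinuousLinearMap.comp_assoc]
  have e : hX.trans m (m + n : ℕ) = hX.trans 0 n := by
    have := hX.trans_add_nat 0 n m
    rwa [zero_add, add_comm, ← Nat.cast_add] at this
  rw [h n, e]

lemma norm_trans_antitone (f : Lp ℝ 2 π) {m n : ℕ} (hmn : m ≤ n) :
    ‖hX.trans 0 n f‖ ≤ ‖hX.trans 0 m f‖ := by
  obtain ⟨k, rfl⟩ := Nat.exists_eq_add_of_le' hmn
  rw [hX.trans_comp k m, ContinuousLinearMap.comp_apply]
  exact hX.norm_trans_le 0 k _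

/-- A contraction that almost preserves the norm of `f` is almost undone on `f` by its adjoint. -/
lemma norm_adjoint_sub_sq_le (n : ℤ) (f : Lp ℝ 2 π) :
    ‖hX.trans n 0 (hX.trans 0 n f) - f‖ ^ 2 ≤ ‖f‖ ^ 2 - ‖hX.trans 0 n f‖ ^ 2 := by
  have h1 := hX.norm_trans_le n 0 (hX.trans 0 n f)
  have h2 : ⟪hX.trans n 0 (hX.trans 0 n f), f⟫ = ‖hX.trans 0 n f‖ ^ 2 := by
    rw [inner_trans, real_inner_comm, ← inner_trans, real_inner_self_eq_norm_sq]
  rw [norm_sub_sq_real, h2]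
  nlinarith [norm_nonneg (hX.trans n 0 (hX.trans 0 n f))]

lemma trans_univ (m n : ℤ) : hX.trans m n (ind π .univ) = ind π .univ :=
  ext_inner_ind fun A hA => by
    rw [inner_trans_ind, inner_ind_ind, preimage_univ, univ_inter, univ_inter]
    exact (hX.measurePreserving m).measureReal_preimage hA.nullMeasurableSet

/-- Conditional expectations preserve the mean. -/
lemma inner_trans_univ (m n : ℤ) (f : Lp ℝ 2 π) :
    ⟪hX.trans m n f, ind π .univ⟫ = ⟪f, ind π .univ⟫ := by
  rw [inner_trans, real_inner_comm, ← inner_trans, trans_univ, real_inner_comm]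

lemma trans_nonneg (m n : ℤ) {f : Lp ℝ 2 π} (hf : 0 ≤ᵐ[π] f) : 0 ≤ᵐ[π] hX.trans m n f := by
  have hL : ∀ f : Lp ℝ 2 π, Integrable f π := fun f => (Lp.memLp f).integrable (by norm_num)
  refine ae_nonneg_of_forall_setIntegral_nonneg (hL _) fun A hA _ => ?_
  rw [← inner_ind_left π hA, real_inner_comm, inner_trans, real_inner_comm, lift_ind,
    inner_ind_left]
  refine integral_nonneg_of_ae (ae_restrict_of_ae ?_)
  filter_upwards [hX.coeFn_lift n f,
    (hX.measurePreserving n).quasiMeasurePreserving.ae hf] with ω h1 h2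
  rw [h1]
  exact h2

lemma trans_le_one (m n : ℤ) {f : Lp ℝ 2 π} (hf : ∀ᵐ x ∂π, |f x| ≤ 1) :
    ∀ᵐ x ∂π, |hX.trans m n f x| ≤ 1 := by
  have h1 := hX.trans_nonneg m n (f := ind π .univ - f) (by
    filter_upwards [hf, Lp.coeFn_sub (ind π .univ) f, coeFn_ind π .univ] with x h1 h2 h3
    rw [h2, Pi.sub_apply, h3]
    simpa using (abs_le.1 h1).2)
  have h2 := hX.trans_nonneg m n (f := ind π .univ + f) (by
    filter_upwards [hf, Lp.coeFn_add (ind π .univ) f, coeFn_ind π .univ] with x h1 h2 h3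
    rw [h2, Pi.add_apply, h3]
    simpa [neg_le_iff_add_nonneg'] using (abs_le.1 h1).1)
  rw [map_sub, trans_univ] at h1
  rw [map_add, trans_univ] at h2
  filter_upwards [h1, h2, Lp.coeFn_sub (ind π .univ) (hX.trans m n f),
    Lp.coeFn_add (ind π .univ) (hX.trans m n f), coeFn_ind π .univ] with x a1 a2 b1 b2 c
  rw [b1, Pi.sub_apply, c] at a1
  rw [b2, Pi.add_apply, c] at a2
  simp at a1 a2
  exact abs_le.2 ⟨by linarith, a1⟩

end IsStationaryMarkov
end Transition

/-! ### Events of the future that are determined by the present -/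

section Deterministic

open scoped symmDiff

variable {Ω S : Type*} [MeasurableSpace Ω] [MeasurableSpace S]

/-- The event `X n ∈ A` coincides with an event `X 0 ∈ B` up to probability `ε`. -/
def NearDet (X : ℤ → Ω → S) (P : Measure Ω) (n : ℤ) (ε : ℝ) (A : Set S) : Prop :=
  MeasurableSet A ∧ ∃ B, MeasurableSet B ∧ P.real ((X n ⁻¹' A) ∆ (X 0 ⁻¹' B)) ≤ ε

/-- A set of states is deterministic if, for every `n ≥ 0`, the present state decides almost surely
whether `X n` lies in it. -/
def Deterministic (X : ℤ → Ω → S) (P : Measure Ω) (A : Set S) : Prop :=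
  MeasurableSet A ∧ ∀ n : ℕ, ∃ B, MeasurableSet B ∧ X n ⁻¹' A =ᵐ[P] X 0 ⁻¹' B

variable {P : Measure Ω} [IsProbabilityMeasure P] {π : Measure S} [IsProbabilityMeasure π]
  {X : ℤ → Ω → S}

lemma NearDet.mono {n : ℤ} {ε ε' : ℝ} {A : Set S} (h : NearDet X P n ε A) (hε : ε ≤ ε') :
    NearDet X P n ε' A :=
  ⟨h.1, h.2.imp fun _ hB => ⟨hB.1, hB.2.trans hε⟩⟩

lemma NearDet.compl {n : ℤ} {ε : ℝ} {A : Set S} (h : NearDet X P n ε A) :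
    NearDet X P n ε Aᶜ := by
  obtain ⟨hA, B, hB, h⟩ := h
  refine ⟨hA.compl, Bᶜ, hB.compl, ?_⟩
  rwa [preimage_compl, preimage_compl, compl_symmDiff_compl]

lemma NearDet.inter {n : ℤ} {ε ε' : ℝ} {A A' : Set S} (h : NearDet X P n ε A)
    (h' : NearDet X P n ε' A') : NearDet X P n (ε + ε') (A ∩ A') := by
  obtain ⟨hA, B, hB, h⟩ := h
  obtain ⟨hA', B', hB', h'⟩ := h'
  refine ⟨hA.inter hA', B ∩ B', hB.inter hB', ?_⟩
  refine le_trans (measureReal_mono ?_) ((measureReal_union_le _ _).trans (add_le_add h h'))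
  intro ω
  simp only [mem_symmDiff, mem_preimage, mem_inter_iff, mem_union]
  tauto

lemma NearDet.union {n : ℤ} {ε ε' : ℝ} {A A' : Set S} (h : NearDet X P n ε A)
    (h' : NearDet X P n ε' A') : NearDet X P n (ε + ε') (A ∪ A') := by
  simpa [compl_inter] using (h.compl.inter h'.compl).compl

lemma Deterministic.nearDet {A : Set S} (h : Deterministic X P A) (n : ℕ) :
    NearDet X P n 0 A := by
  obtain ⟨B, hB, h'⟩ := h.2 n
  refine ⟨h.1, B, hB, ?_⟩
  rw [measureReal_def, measure_symmDiff_eq_zero_iff.2 h', ENNReal.toReal_zero]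

lemma Deterministic.compl {A : Set S} (h : Deterministic X P A) : Deterministic X P Aᶜ := by
  refine ⟨h.1.compl, fun n => ?_⟩
  obtain ⟨B, hB, h'⟩ := h.2 n
  exact ⟨Bᶜ, hB.compl, h'.compl⟩

lemma Deterministic.iUnion {ι : Sort*} [Countable ι] {A : ι → Set S}
    (h : ∀ i, Deterministic X P (A i)) : Deterministic X P (⋃ i, A i) := by
  refine ⟨.iUnion fun i => (h i).1, fun n => ?_⟩
  choose B hB h' using fun i => (h i).2 n
  refine ⟨⋃ i, B i, .iUnion hB, ?_⟩
  rw [preimage_iUnion, preimage_iUnion]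
  exact Filter.EventuallyEq.countable_iUnion h'

lemma Deterministic.inter {A A' : Set S} (h : Deterministic X P A) (h' : Deterministic X P A') :
    Deterministic X P (A ∩ A') := by
  refine ⟨h.1.inter h'.1, fun n => ?_⟩
  obtain ⟨B, hB, e⟩ := h.2 n
  obtain ⟨B', hB', e'⟩ := h'.2 n
  exact ⟨B ∩ B', hB.inter hB', e.inter e'⟩

namespace IsStationaryMarkov

variable (hX : IsStationaryMarkov X P π)
include hX

lemma measure_preimage (n : ℤ) {A : Set S} (hA : MeasurableSet A) : P (X n ⁻¹' A) = π A :=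
  (hX.measurePreserving n).measure_preimage hA.nullMeasurableSet

lemma preimage_ae_eq_add_one {m n : ℤ} {A B : Set S} (hA : MeasurableSet A)
    (hB : MeasurableSet B) :
    X (m + 1) ⁻¹' A =ᵐ[P] X (n + 1) ⁻¹' B ↔ X m ⁻¹' A =ᵐ[P] X n ⁻¹' B := by
  simp only [ae_eq_set, sdiff_eq, ← preimage_compl]
  rw [hX.shift m n A Bᶜ hA hB.compl, hX.shift n m B Aᶜ hB hA.compl]

lemma preimage_ae_eq_add {m n : ℤ} {A B : Set S} (hA : MeasurableSet A)
    (hB : MeasurableSet B) (k : ℤ) (h : X m ⁻¹' A =ᵐ[P] X n ⁻¹' B) :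
    X (k + m) ⁻¹' A =ᵐ[P] X (k + n) ⁻¹' B := by
  induction k with
  | zero => simpa using h
  | succ k ih =>
    rw [add_right_comm, add_right_comm _ 1 n]
    exact (hX.preimage_ae_eq_add_one hA hB).2 ih
  | pred k ih =>
    refine (hX.preimage_ae_eq_add_one hA hB).1 ?_
    rwa [show -(k : ℤ) - 1 + m + 1 = -k + m by ring, show -(k : ℤ) - 1 + n + 1 = -k + n by ring]

/-- The images of a deterministic set under the transition operators. -/
lemma exists_orbit {A : Set S} (hA : Deterministic X P A) :
    ∃ B : ℕ → Set S, B 0 = A ∧ (∀ j, MeasurableSet (B j)) ∧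
      ∀ (i : ℤ) (j : ℕ), X (i + j) ⁻¹' A =ᵐ[P] X i ⁻¹' B j := by
  choose B hB h using hA.2
  refine ⟨fun j => if j = 0 then A else B j, if_pos rfl, fun j => ?_, fun i j => ?_⟩ <;> dsimp only
  · split_ifs
    exacts [hA.1, hB j]
  · split_ifs with hj
    · simp only [hj, Nat.cast_zero, add_zero]
      exact EventuallyEq.rfl
    · simpa using hX.preimage_ae_eq_add hA.1 (hB j) i (h j)

omit hX in
lemma orbit_succ {A : Set S} {B : ℕ → Set S}
    (h : ∀ (i : ℤ) (j : ℕ), X (i + j) ⁻¹' A =ᵐ[P] X i ⁻¹' B j) (i : ℤ) (j : ℕ) :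
    X (i + 1) ⁻¹' B j =ᵐ[P] X i ⁻¹' B (j + 1) := by
  refine (h (i + 1) j).symm.trans ?_
  have := h i (j + 1)
  push_cast at this
  rwa [add_assoc, add_comm 1 (j : ℤ)]

omit hX in
lemma orbit_deterministic {A : Set S} {B : ℕ → Set S} (hB : ∀ j, MeasurableSet (B j))
    (h : ∀ (i : ℤ) (j : ℕ), X (i + j) ⁻¹' A =ᵐ[P] X i ⁻¹' B j) (j : ℕ) :
    Deterministic X P (B j) := by
  refine ⟨hB j, fun n => ⟨B (n + j), hB _, (h n j).symm.trans ?_⟩⟩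
  simpa using h 0 (n + j)

lemma orbit_measure {A : Set S} (hA : MeasurableSet A) {B : ℕ → Set S}
    (hB : ∀ j, MeasurableSet (B j))
    (h : ∀ (i : ℤ) (j : ℕ), X (i + j) ⁻¹' A =ᵐ[P] X i ⁻¹' B j) (j : ℕ) : π (B j) = π A := by
  rw [← hX.measure_preimage 0 (hB j), ← hX.measure_preimage (0 + j) hA]
  exact (measure_congr (h 0 j)).symm

lemma orbit_inter {A : Set S} (hA : MeasurableSet A) {B : ℕ → Set S}
    (hB : ∀ j, MeasurableSet (B j))
    (h : ∀ (i : ℤ) (j : ℕ), X (i + j) ⁻¹' A =ᵐ[P] X i ⁻¹' B j) (i j : ℕ) :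
    π (B i ∩ B (i + j)) = π (A ∩ B j) := by
  rw [← hX.measure_preimage 0 ((hB i).inter (hB _)), ← hX.measure_preimage i (hA.inter (hB j)),
    preimage_inter, preimage_inter]
  refine measure_congr (((h 0 i).symm.inter (h 0 (i + j)).symm).trans ?_)
  have h1 := h i j
  simp only [zero_add, Nat.cast_add]
  exact (ae_eq_refl _).inter h1

/-- In an ergodic chain the images of a deterministic set of positive measure cover everything. -/
lemma measure_iUnion_orbit
    (herg : ∀ W : Set S, MeasurableSet W → X 1 ⁻¹' W =ᵐ[P] X 0 ⁻¹' W → π W = 0 ∨ π W = 1)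
    {A : Set S} (hA : MeasurableSet A) {B : ℕ → Set S}
    (hB : ∀ j, MeasurableSet (B j))
    (h : ∀ (i : ℤ) (j : ℕ), X (i + j) ⁻¹' A =ᵐ[P] X i ⁻¹' B j) (hpos : π A ≠ 0) :
    π (⋃ j, B j) = 1 := by
  have hW : MeasurableSet (⋃ j, B j) := .iUnion hB
  refine (herg _ hW ?_).resolve_left fun h0 => hpos ?_
  · have h1 : X 1 ⁻¹' (⋃ j, B j) =ᵐ[P] X 0 ⁻¹' (⋃ j, B (j + 1)) := by
      rw [preimage_iUnion, preimage_iUnion]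
      exact Filter.EventuallyEq.countable_iUnion fun j => by simpa using orbit_succ h 0 j
    refine h1.trans (ae_eq_of_subset_of_measure_ge ?_ ?_ ?_ (measure_ne_top _ _))
    · exact preimage_mono (iUnion_subset fun j => subset_iUnion _ (j + 1))
    · rw [← measure_congr h1, hX.measure_preimage 0 hW, hX.measure_preimage 1 hW]
    · exact ((hX.measurePreserving 0).measurable
        (.iUnion fun j => hB (j + 1))).nullMeasurableSet
  · rw [← hX.orbit_measure hA hB h 0]
    exact measure_mono_null (subset_iUnion _ 0) h0

/-- If no set of measure close to `1 / 2` is nearly deterministic at time `s`, then deterministic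
sets of positive measure cannot be small: the unions of the images of such a set grow to full
measure in small steps. -/
lemma le_measure_of_deterministic
    (herg : ∀ W : Set S, MeasurableSet W → X 1 ⁻¹' W =ᵐ[P] X 0 ⁻¹' W → π W = 0 ∨ π W = 1)
    {s : ℕ} {ε : ℝ} (hε : 0 < ε) (hbal : ∀ A, NearDet X P s ε A → ε ≤ |π.real A - 1 / 2|)
    {A : Set S} (hA : Deterministic X P A) (hpos : π A ≠ 0) : ε ≤ π.real A := by
  by_contra! hlt
  obtain ⟨B, -, hB, h⟩ := hX.exists_orbit hA
  have hlim := tendsto_measure_iUnion_accumulate (μ := π) (f := B)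
  rw [hX.measure_iUnion_orbit herg hA.1 hB h hpos] at hlim
  have hlim' : Tendsto (fun n => π.real (accumulate B n)) atTop (𝓝 1) :=
    (ENNReal.tendsto_toReal ENNReal.one_ne_top).comp hlim
  have hdet : ∀ n, Deterministic X P (accumulate B n) := fun n => by
    rw [accumulate_def]
    exact Deterministic.iUnion fun i => Deterministic.iUnion fun _ => orbit_deterministic hB h i
  have hm : ∀ n, π.real (B n) = π.real A := fun n => by
    rw [measureReal_def, hX.orbit_measure hA.1 hB h, measureReal_def]
  have hb : ∀ n, ε ≤ |π.real (accumulate B n) - 1 / 2| := fun n =>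
    hbal _ (((hdet n).nearDet s).mono hε.le)
  have hsmall : ∀ n, π.real (accumulate B n) ≤ 1 / 2 - ε := by
    intro n
    induction n with
    | zero =>
      have h0 : π.real (accumulate B 0) = π.real A := by rw [accumulate_zero_nat, hm]
      rcases abs_cases (π.real (accumulate B 0) - 1 / 2) with h | h <;> linarith [hb 0]
    | succ n ih =>
      have h1 : π.real (accumulate B (n + 1)) ≤ π.real (accumulate B n) + π.real A := by
        rw [accumulate_succ, ← hm (n + 1)]
        exact measureReal_union_le _ _
      rcases abs_cases (π.real (accumulate B (n + 1)) - 1 / 2) with h | h <;> linarith [hb (n + 1)]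
  have := le_of_tendsto hlim' (Eventually.of_forall hsmall)
  linarith

/-- A deterministic set that has no deterministic subset of intermediate measure. -/
lemma exists_atom
    (herg : ∀ W : Set S, MeasurableSet W → X 1 ⁻¹' W =ᵐ[P] X 0 ⁻¹' W → π W = 0 ∨ π W = 1)
    {s : ℕ} {ε : ℝ} (hε : 0 < ε) (hbal : ∀ A, NearDet X P s ε A → ε ≤ |π.real A - 1 / 2|) :
    ∃ E, Deterministic X P E ∧ π E ≠ 0 ∧
      ∀ F, Deterministic X P F → π (E ∩ F) = 0 ∨ π (E ∩ Fᶜ) = 0 := by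
  set T : Set ℝ := {r | ∃ E, Deterministic X P E ∧ π E ≠ 0 ∧ π.real E = r} with hT
  have hne : T.Nonempty :=
    ⟨_, univ, ⟨.univ, fun n => ⟨univ, .univ, by simp⟩⟩, by simp, rfl⟩
  have hlow : ∀ r ∈ T, ε ≤ r := by
    rintro _ ⟨E, hE, h0, rfl⟩
    exact hX.le_measure_of_deterministic herg hε hbal hE h0
  have hι : ε ≤ sInf T := le_csInf hne hlow
  obtain ⟨_, ⟨E, hE, h0, rfl⟩, hlt⟩ := exists_lt_of_csInf_lt hne
    (show sInf T < 2 * sInf T by linarith)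
  refine ⟨E, hE, h0, fun F hF => ?_⟩
  by_contra! hcon
  have hbdd : BddBelow T := ⟨ε, hlow⟩
  have h1 := csInf_le hbdd ⟨_, hE.inter hF, hcon.1, rfl⟩
  have h2 := csInf_le hbdd ⟨_, hE.inter hF.compl, hcon.2, rfl⟩
  have h3 := measureReal_inter_add_sdiff (μ := π) (s := E) hF.1
  rw [sdiff_eq] at h3
  linarith

/-- Some image of a deterministic set of positive measure meets that set again. -/
lemma exists_orbit_inter_ne_zero {A : Set S} (hA : MeasurableSet A) {B : ℕ → Set S}
    (hB : ∀ j, MeasurableSet (B j))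
    (h : ∀ (i : ℤ) (j : ℕ), X (i + j) ⁻¹' A =ᵐ[P] X i ⁻¹' B j) (hpos : π A ≠ 0) :
    ∃ d, 1 ≤ d ∧ π (A ∩ B d) ≠ 0 := by
  by_contra! hcon
  have hdis : Pairwise (Function.onFun (AEDisjoint π) B) := by
    have : ∀ i j, i < j → π (B i ∩ B j) = 0 := fun i j hij => by
      obtain ⟨k, rfl⟩ := Nat.exists_eq_add_of_lt hij
      rw [add_assoc, hX.orbit_inter hA hB h]
      exact hcon _ (by omega)
    intro i j hij
    rcases hij.lt_or_gt with hij | hij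
    · exact this i j hij
    · rw [Function.onFun, AEDisjoint, inter_comm]
      exact this j i hij
  have h1 := measure_iUnion₀ hdis fun j => (hB j).nullMeasurableSet
  simp_rw [hX.orbit_measure hA hB h] at h1
  rw [ENNReal.tsum_const_eq_top_of_ne_zero hpos] at h1
  exact measure_ne_top _ _ h1

end IsStationaryMarkov

end Deterministic

/-! ### Deterministic sets of an ergodic aperiodic chain are trivial -/

section Cycles

variable {Ω : Type*} [MeasurableSpace Ω] {P : Measure Ω} [IsProbabilityMeasure P]
  {π : Measure ℝ} [IsProbabilityMeasure π] {X : ℤ → Ω → ℝ}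

namespace IsStationaryMarkov

variable (hX : IsStationaryMarkov X P π)
include hX

/-- A deterministic set that returns to itself after `d` steps and whose images are disjoint until
then gives rise to a cycle of length `d`. -/
lemma hasCycle_of_return
    (herg : ∀ W : Set ℝ, MeasurableSet W → X 1 ⁻¹' W =ᵐ[P] X 0 ⁻¹' W → π W = 0 ∨ π W = 1)
    {A : Set ℝ} (hA : MeasurableSet A) {B : ℕ → Set ℝ}
    (hB : ∀ j, MeasurableSet (B j))
    (h : ∀ (i : ℤ) (j : ℕ), X (i + j) ⁻¹' A =ᵐ[P] X i ⁻¹' B j) (hpos : π A ≠ 0)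
    {d : ℕ} (hd : 2 ≤ d) (hdis : ∀ j, 1 ≤ j → j < d → π (A ∩ B j) = 0)
    (hret : B d =ᵐ[π] B 0) : HasCycle X P d := by
  have : NeZero d := ⟨by omega⟩
  have hdisj : ∀ r < d, (disjointed B r : Set ℝ) =ᵐ[π] B r := by
    intro r hr
    have : ∀ i, ∀ _ : i < r, ((B i)ᶜ ∩ B r : Set ℝ) =ᵐ[π] B r := by
      intro i hi
      obtain ⟨k, rfl⟩ := Nat.exists_eq_add_of_lt hi
      have h0 : π (B i ∩ B (i + k + 1)) = 0 := by
        rw [add_assoc, hX.orbit_inter hA hB h]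
        exact hdis _ (by omega) (by omega)
      refine ae_eq_set.2 ⟨?_, ?_⟩
      · rw [inter_sdiff_assoc]; simp
      · convert h0 using 2
        ext x; simp; tauto
    have hall : ∀ᵐ x ∂π, ∀ i, i < r → (x ∈ (B i)ᶜ ∩ B r ↔ x ∈ B r) := by
      rw [ae_all_iff]
      intro i
      by_cases hi : i < r
      · filter_upwards [(this i hi).mem_iff] with x hx _ using hx
      · simp [hi]
    refine Filter.eventuallyEq_set.2 ?_
    filter_upwards [hall] with x hx
    rw [disjointed_eq_inter_compl]
    simp only [mem_inter_iff, mem_iInter]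
    refine ⟨fun h => h.1, fun h => ⟨h, fun i hi => ((hx i hi).2 h).1⟩⟩
  have hpull : ∀ {C D : Set ℝ} (n : ℤ), C =ᵐ[π] D → X n ⁻¹' C =ᵐ[P] X n ⁻¹' D := fun n hCD =>
    (hX.measurePreserving n).quasiMeasurePreserving.preimage_ae_eq hCD
  -- Moving one step forward lowers the index of the image that contains the state.
  set G : ZMod d → Set ℝ := fun i => disjointed B (-i).val with hG
  have hstep : ∀ (n : ℤ) (i : ZMod d), X n ⁻¹' G i =ᵐ[P] X (n + 1) ⁻¹' G (i + 1) := by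
    intro n i
    have h1 := hpull n (hdisj (-i).val (ZMod.val_lt _))
    have h2 := hpull (n + 1) (hdisj (-(i + 1)).val (ZMod.val_lt _))
    refine h1.trans (EventuallyEq.trans ?_ h2.symm)
    have hval : (-(i + 1)).val + 1 = (-i).val ∨ (-(i + 1)).val + 1 = d ∧ (-i).val = 0 := by
      have e : -i = -(i + 1) + 1 := by ring
      have hlt := ZMod.val_lt (-(i + 1))
      rcases Nat.lt_or_ge ((-(i + 1)).val + 1) d with hc | hc
      · left
        rw [e, ZMod.val_add, ZMod.val_one'' (by omega), Nat.mod_eq_of_lt hc]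
      · right
        refine ⟨by omega, ?_⟩
        rw [e, ZMod.val_add, ZMod.val_one'' (by omega), show (-(i + 1)).val + 1 = d by omega,
          Nat.mod_self]
    rcases hval with hv | ⟨hv, hv0⟩
    · rw [← hv]
      exact (orbit_succ h n _).symm
    · rw [hv0]
      have h3 := orbit_succ h n (-(i + 1)).val
      rw [hv] at h3
      exact (hpull n hret).symm.trans h3.symm
  have hGm : ∀ i, MeasurableSet (G i) := fun i => MeasurableSet.disjointed hB _
  have hW : MeasurableSet (⋃ i, G i) := .iUnion hGm
  have hfull : π (⋃ i, G i) = 1 := by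
    refine (herg _ hW ?_).resolve_left fun h0 => hpos ?_
    · rw [preimage_iUnion, preimage_iUnion]
      have h1 : (⋃ i, X 1 ⁻¹' G i) = ⋃ i, X 1 ⁻¹' G (i + 1) :=
        ((Equiv.addRight (1 : ZMod d)).surjective.iUnion_comp fun i => X 1 ⁻¹' G i).symm
      rw [h1]
      exact (Filter.EventuallyEq.countable_iUnion fun i => hstep 0 i).symm
    · rw [← hX.orbit_measure hA hB h 0]
      have e : G 0 = B 0 := by simp [hG]
      exact measure_mono_null (e ▸ subset_iUnion G 0) h0
  refine ⟨G, hGm, fun i j hij => ?_, fun n => ?_, fun n i => ?_⟩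
  · refine disjoint_disjointed B fun hv => hij ?_
    exact neg_injective (ZMod.val_injective d hv)
  · have : ∀ᵐ x ∂π, x ∈ ⋃ i, G i := by
      rwa [← prob_compl_eq_zero_iff hW] at hfull
    filter_upwards [(hX.measurePreserving n).quasiMeasurePreserving.ae this] with ω hω
    exact mem_iUnion.1 hω
  · filter_upwards [(hstep n i).mem_iff] with ω hω using hω.1

/-- Under ergodicity and aperiodicity a deterministic set has probability `0` or `1`, unless there
are nearly deterministic sets of measure close to `1 / 2`. -/
lemma deterministic_trivial
    (herg : ∀ W : Set ℝ, MeasurableSet W → X 1 ⁻¹' W =ᵐ[P] X 0 ⁻¹' W → π W = 0 ∨ π W = 1)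
    (haper : IsAperiodicChain X P)
    {s : ℕ} {ε : ℝ} (hε : 0 < ε) (hbal : ∀ A, NearDet X P s ε A → ε ≤ |π.real A - 1 / 2|)
    {F : Set ℝ} (hF : Deterministic X P F) : π F = 0 ∨ π F = 1 := by
  classical
  obtain ⟨E, hE, hpos, hatom⟩ := hX.exists_atom herg hε hbal
  obtain ⟨B, hB0, hB, h⟩ := hX.exists_orbit hE
  have hex := hX.exists_orbit_inter_ne_zero hE.1 hB h hpos
  set d := Nat.find hex with hd
  obtain ⟨hd1, hd0⟩ : 1 ≤ d ∧ π (E ∩ B d) ≠ 0 := Nat.find_spec hex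
  have hdis : ∀ j, 1 ≤ j → j < d → π (E ∩ B j) = 0 := fun j h1 h2 => by
    by_contra hne
    exact Nat.find_min hex h2 ⟨h1, hne⟩
  have hret : B d =ᵐ[π] B 0 := by
    have h1 := (hatom (B d) (orbit_deterministic hB h d)).resolve_left hd0
    rw [hB0]
    have h2 : E ≤ᵐ[π] B d := ae_le_set.2 (by rwa [sdiff_eq])
    exact (ae_eq_of_ae_subset_of_measure_ge h2 (hX.orbit_measure hE.1 hB h d).le
      hE.1.nullMeasurableSet (measure_ne_top _ _)).symm
  have hd1 : d = 1 := by
    by_contra hne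
    exact haper d (by omega)
      (hX.hasCycle_of_return herg hE.1 hB h hpos (by omega) hdis hret)
  have hE1 : π E = 1 := by
    refine (herg E hE.1 ?_).resolve_left hpos
    rw [hd1] at hret
    have h1 := h 0 1
    simp only [zero_add, Nat.cast_one] at h1
    refine h1.trans ?_
    rw [← hB0]
    exact (hX.measurePreserving 0).quasiMeasurePreserving.preimage_ae_eq hret
  have hEc : π Eᶜ = 0 := (prob_compl_eq_zero_iff hE.1).2 hE1
  have key : ∀ G, π (E ∩ G) = 0 → π G = 0 := fun G hG => by
    refine measure_mono_null (t := (E ∩ G) ∪ Eᶜ) ?_ (measure_union_null hG hEc)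
    intro x hx
    by_cases hxE : x ∈ E
    exacts [Or.inl ⟨hxE, hx⟩, Or.inr hxE]
  rcases hatom F hF with h0 | h0
  · exact Or.inl (key _ h0)
  · exact Or.inr ((prob_compl_eq_zero_iff hF.1).1 (key _ h0))

end IsStationaryMarkov

end Cycles

/-! ### Nearly deterministic sets from slowly decaying correlations -/

section Approximation

open scoped RealInnerProductSpace symmDiff

/-- The superlevel sets of two functions that are close in mean differ little at some level. -/
lemma exists_level {Ω : Type*} [MeasurableSpace Ω] {P : Measure Ω} [IsProbabilityMeasure P]
    {u v : Ω → ℝ} (hu : Measurable u) (hv : Measurable v)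
    (huv : Integrable (fun ω => u ω - v ω) P) {b : ℝ} (hb : 0 < b) :
    ∃ t ∈ Icc 0 b, P.real ({ω | t < u ω} ∆ {ω | t < v ω}) ≤ b⁻¹ * ∫ ω, |u ω - v ω| ∂P := by
  set Q : Set (ℝ × Ω) := {q | q.1 < u q.2} ∆ {q | q.1 < v q.2} with hQ
  have hQm : MeasurableSet Q :=
    (measurableSet_lt measurable_fst (hu.comp measurable_snd)).symmDiff
      (measurableSet_lt measurable_fst (hv.comp measurable_snd))
  have h1 : ∫⁻ t in Icc 0 b, P (Prod.mk t ⁻¹' Q) ≤ ENNReal.ofReal (∫ ω, |u ω - v ω| ∂P) := by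
    rw [← Measure.prod_apply hQm, Measure.prod_apply_symm hQm,
      ofReal_integral_eq_lintegral_ofReal huv.abs (Eventually.of_forall fun _ => abs_nonneg _)]
    refine lintegral_mono fun ω => (Measure.restrict_apply_le _ _).trans ?_
    rw [← Real.volume_interval]
    refine measure_mono fun t ht => ?_
    simp only [hQ, mem_preimage, mem_symmDiff, mem_ofPred_eq, not_lt] at ht
    rcases ht with ⟨h, h'⟩ | ⟨h, h'⟩
    exacts [mem_uIcc.2 (Or.inl ⟨h', h.le⟩), mem_uIcc.2 (Or.inr ⟨h', h.le⟩)]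
  have hvol : volume (Icc 0 b) = ENNReal.ofReal b := by simp
  have hne : volume (Icc 0 b) ≠ 0 := by simpa [hvol] using hb
  obtain ⟨t, ht, hle⟩ := exists_le_setLAverage (μ := volume) (s := Icc 0 b)
    (f := fun t => P (Prod.mk t ⁻¹' Q)) hne (by simp)
    (measurable_measure_prodMk_left hQm).aemeasurable
  refine ⟨t, ht, ?_⟩
  rw [setLAverage_eq, hvol] at hle
  have h2 : P ({ω | t < u ω} ∆ {ω | t < v ω}) ≤
      ENNReal.ofReal (∫ ω, |u ω - v ω| ∂P) / ENNReal.ofReal b :=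
    hle.trans (ENNReal.div_le_div_right h1 _)
  rw [← ENNReal.ofReal_div_of_pos hb] at h2
  refine (ENNReal.toReal_mono ENNReal.ofReal_ne_top h2).trans_eq ?_
  rw [ENNReal.toReal_ofReal (by positivity), div_eq_inv_mul]

/-- Bounded sequences of a Hilbert space converge weakly along an ultrafilter. -/
lemma exists_weak_limit {H : Type*} [NormedAddCommGroup H] [InnerProductSpace ℝ H]
    [CompleteSpace H] (U : Ultrafilter ℕ) (f : ℕ → H) {r : ℝ} (hf : ∀ n, ‖f n‖ ≤ r) :
    ∃ h, ∀ y, Tendsto (fun n => ⟪f n, y⟫) U (𝓝 ⟪h, y⟫) := by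
  set φ : ℕ → WeakDual ℝ H := fun n => StrongDual.toWeakDual (innerSL ℝ (f n)) with hφ
  obtain ⟨ψ, -, hψ⟩ := (WeakDual.isCompact_closedBall (𝕜 := ℝ) (0 : StrongDual ℝ H)
    r).ultrafilter_le_nhds (U.map φ) (by
      refine le_principal_iff.2 (Filter.mem_map.2 (Eventually.of_forall fun n => ?_))
      simpa [hφ] using hf n)
  refine ⟨(InnerProductSpace.toDual ℝ H).symm (WeakDual.toStrongDual ψ), fun y => ?_⟩
  rw [InnerProductSpace.toDual_symm_apply]
  exact ((WeakDual.eval_continuous y).tendsto ψ).comp hψ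

variable {Ω S : Type*} [MeasurableSpace Ω] [MeasurableSpace S]
  {P : Measure Ω} [IsProbabilityMeasure P] {π : Measure S} [IsProbabilityMeasure π]
  {X : ℤ → Ω → S}

lemma integrable_coeFn (f : Lp ℝ 2 π) : Integrable f π := (Lp.memLp f).integrable (by norm_num)

lemma norm_ind_univ : ‖ind π .univ‖ = 1 := by
  have h := inner_ind_ind π .univ .univ
  rw [real_inner_self_eq_norm_sq, inter_self, probReal_univ] at h
  exact (pow_eq_one_iff_of_nonneg (norm_nonneg _) two_ne_zero).1 h

lemma norm_ind_le_one {A : Set S} (hA : MeasurableSet A) : ‖ind π hA‖ ≤ 1 := by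
  have h := inner_ind_ind π hA hA
  rw [real_inner_self_eq_norm_sq] at h
  exact (sq_le_one_iff₀ (norm_nonneg _)).1 (h ▸ measureReal_le_one)

lemma integral_sq_eq (f : Lp ℝ 2 π) : ∫ x, f x ^ 2 ∂π = ‖f‖ ^ 2 := by
  rw [← real_inner_self_eq_norm_sq, L2.inner_def]
  refine integral_congr_ae (Eventually.of_forall fun x => ?_)
  simp

lemma integral_abs_le_norm (f : Lp ℝ 2 π) : ∫ x, |f x| ∂π ≤ ‖f‖ := by
  have h := real_inner_le_norm (ind π .univ) |f|
  rw [inner_ind_left, norm_ind_univ, one_mul, norm_abs_eq_norm, Measure.restrict_univ] at h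
  refine le_trans (le_of_eq (integral_congr_ae ?_)) h
  filter_upwards [Lp.coeFn_abs f] with x hx using hx.symm

lemma integrable_sq (f : Lp ℝ 2 π) : Integrable (fun x => f x ^ 2) π := (Lp.memLp f).integrable_sq

/-- A bounded function with mean `0` has a superlevel set of intermediate measure at every small
level. -/
lemma measure_level {g : Lp ℝ 2 π} (hg : ∀ᵐ x ∂π, |g x| ≤ 1) (hmean : ⟪g, ind π .univ⟫ = 0)
    {c : ℝ} (hc : c ≤ ‖g‖ ^ 2) {t : ℝ} (ht : t ∈ Icc 0 (c / 4)) :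
    c / 4 ≤ π.real {x | t < g x} ∧ π.real {x | t < g x} ≤ 1 - c / 4 := by
  have hgm : Measurable g := (Lp.stronglyMeasurable g).measurable
  have hA : MeasurableSet {x | t < g x} := measurableSet_lt measurable_const hgm
  have hI := integrable_coeFn g
  have h0 : ∫ x, g x ∂π = 0 := by
    rw [real_inner_comm, inner_ind_left, Measure.restrict_univ] at hmean
    exact hmean
  have hsq : c ≤ ∫ x, |g x| ∂π := by
    refine (hc.trans_eq (integral_sq_eq g).symm).trans
      (integral_mono_ae (integrable_sq g) hI.abs ?_)
    filter_upwards [hg] with x hx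
    rw [← sq_abs]
    nlinarith [abs_nonneg (g x)]
  have hind : Integrable ({x | t < g x}.indicator fun _ => (1 : ℝ)) π :=
    (integrable_const 1).indicator hA
  have hindint : ∫ x, {x | t < g x}.indicator (fun _ => (1 : ℝ)) x ∂π = π.real {x | t < g x} := by
    rw [integral_indicator_const _ hA, smul_eq_mul, mul_one]
  constructor
  · -- `|g| + g = 2 g⁺ ≤ 2 (t + 1_{g > t})`
    have h1 : ∫ x, (|g x| + g x) ∂π ≤
        ∫ x, (2 * t + 2 * {x | t < g x}.indicator (fun _ => (1 : ℝ)) x) ∂π := by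
      refine integral_mono_ae (hI.abs.add hI) ((integrable_const _).add (hind.const_mul 2)) ?_
      filter_upwards [hg] with x hx
      have := ht.1
      by_cases hx' : t < g x
      · simp only [indicator, mem_ofPred_eq, hx', if_true]
        linarith [abs_le.1 hx, le_abs_self (g x)]
      · simp only [indicator, mem_ofPred_eq, hx', if_false]
        rcases abs_cases (g x) with h | h <;> linarith
    rw [integral_add hI.abs hI, h0, integral_add (integrable_const _) (hind.const_mul 2)] at h1
    simp only [integral_const_mul, hindint, integral_const, probReal_univ, one_smul] at h1
    linarith [ht.2]
  · -- `|g| - g = 2 g⁻ ≤ 2 (1 - 1_{g > t})`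
    have h1 : ∫ x, (|g x| - g x) ∂π ≤
        ∫ x, (2 - 2 * {x | t < g x}.indicator (fun _ => (1 : ℝ)) x) ∂π := by
      refine integral_mono_ae (hI.abs.sub hI) ((integrable_const _).sub (hind.const_mul 2)) ?_
      filter_upwards [hg] with x hx
      have := ht.1
      by_cases hx' : t < g x
      · simp only [indicator, mem_ofPred_eq, hx', if_true]
        rcases abs_cases (g x) with h | h <;> linarith
      · simp only [indicator, mem_ofPred_eq, hx', if_false]
        linarith [abs_le.1 hx, (abs_le.1 hx).1]
    rw [integral_sub hI.abs hI, h0, integral_sub (integrable_const _) (hind.const_mul 2)] at h1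
    simp only [integral_const_mul, hindint, integral_const, probReal_univ, one_smul] at h1
    linarith [ht.2, ht.1]

namespace IsStationaryMarkov

variable (hX : IsStationaryMarkov X P π)
include hX

/-- A bounded centred function whose norm hardly decreases under `trans 0 m` has a nearly
deterministic superlevel set of intermediate measure. -/
lemma exists_nearDet_of_norm {g : Lp ℝ 2 π} (hg : ∀ᵐ x ∂π, |g x| ≤ 1)
    (hmean : ⟪g, ind π .univ⟫ = 0) {c : ℝ} (hc0 : 0 < c) (hc : c ≤ ‖g‖ ^ 2) (m : ℕ) :
    ∃ A, NearDet X P m (4 / c * √(‖g‖ ^ 2 - ‖hX.trans 0 m g‖ ^ 2)) A ∧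
      c / 4 ≤ π.real A ∧ π.real A ≤ 1 - c / 4 := by
  have hm : ∀ f : Lp ℝ 2 π, Measurable f := fun f => (Lp.stronglyMeasurable f).measurable
  have hXm := fun n => (hX.measurePreserving n).measurable
  have hae : (hX.lift m g - hX.lift 0 (hX.trans 0 m g) : Lp ℝ 2 P) =ᵐ[P]
      fun ω => g (X m ω) - hX.trans 0 m g (X 0 ω) := by
    filter_upwards [hX.coeFn_lift m g, hX.coeFn_lift 0 (hX.trans 0 m g),
      Lp.coeFn_sub (hX.lift m g) (hX.lift 0 (hX.trans 0 m g))] with ω h1 h2 h3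
    rw [h3, Pi.sub_apply, h1, h2]
  obtain ⟨t, ht, hle⟩ := exists_level (P := P) ((hm g).comp (hXm m))
    ((hm (hX.trans 0 m g)).comp (hXm 0)) ((integrable_coeFn _).congr hae)
    (b := c / 4) (by positivity)
  refine ⟨{x | t < g x}, ⟨measurableSet_lt measurable_const (hm g), {x | t < hX.trans 0 m g x},
    measurableSet_lt measurable_const (hm _), ?_⟩, measure_level hg hmean hc ht⟩
  refine hle.trans ?_
  rw [inv_div]
  refine mul_le_mul_of_nonneg_left ?_ (by positivity)
  rw [← hX.norm_lift_sub_sq, Real.sqrt_sq (norm_nonneg _)]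
  refine le_trans (le_of_eq (integral_congr_ae ?_)) (integral_abs_le_norm _)
  filter_upwards [hae] with ω hω
  rw [hω]
  rfl

lemma norm_sub_le_of_nearDet {n : ℤ} {ε : ℝ} {A : Set S} (h : NearDet X P n ε A) :
    ‖ind π h.1‖ ^ 2 - ‖hX.trans 0 n (ind π h.1)‖ ^ 2 ≤ ε := by
  obtain ⟨B, hB, hle⟩ := h.2
  refine (hX.norm_sq_sub_le 0 n _ (ind π hB)).trans (le_trans (le_of_eq ?_) hle)
  have hA' := (hX.measurePreserving n).measurable h.1
  have hB' := (hX.measurePreserving 0).measurable hB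
  rw [lift_ind, lift_ind, norm_sub_sq_real, ← real_inner_self_eq_norm_sq,
    ← real_inner_self_eq_norm_sq, inner_ind_ind, inner_ind_ind, inner_ind_ind, inter_self,
    inter_self, measureReal_symmDiff_eq hA' hB',
    ← measureReal_inter_add_sdiff (μ := P) (s := X n ⁻¹' A) hB',
    ← measureReal_inter_add_sdiff (μ := P) (s := X 0 ⁻¹' B) hA', inter_comm (X 0 ⁻¹' B)]
  ring

lemma nearDet_of_norm (n : ℤ) {A : Set S} (hA : MeasurableSet A) :
    NearDet X P n (4 * (‖ind π hA‖ ^ 2 - ‖hX.trans 0 n (ind π hA)‖ ^ 2)) A := by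
  have hm : ∀ f : Lp ℝ 2 π, Measurable f := fun f => (Lp.stronglyMeasurable f).measurable
  set k := hX.trans 0 n (ind π hA) with hk
  have hB : MeasurableSet {x | 1 / 2 < k x} := measurableSet_lt measurable_const (hm k)
  refine ⟨hA, {x | 1 / 2 < k x}, hB, ?_⟩
  have hA' := (hX.measurePreserving n).measurable hA
  have hB' := (hX.measurePreserving 0).measurable hB
  rw [hk, ← hX.norm_lift_sub_sq, ← integral_sq_eq, ← integral_const_mul, ← hk]
  rw [← mul_one (P.real _), ← smul_eq_mul, ← integral_indicator_const _ (hA'.symmDiff hB')]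
  refine integral_mono_ae ((integrable_const 1).indicator (hA'.symmDiff hB'))
    ((integrable_sq _).const_mul 4) ?_
  filter_upwards [hX.coeFn_lift 0 k, Lp.coeFn_sub (hX.lift n (ind π hA)) (hX.lift 0 k),
    coeFn_ind P hA', hX.lift_ind n hA ▸ coeFn_ind P hA'] with ω h1 h2 h3 h4
  rw [h2, Pi.sub_apply, h4, h1]
  by_cases ha : X n ω ∈ A <;> by_cases hb : 1 / 2 < k (X 0 ω) <;>
    simp only [indicator, mem_symmDiff, mem_preimage, mem_ofPred_eq, ha, hb, not_true, not_false_iff,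
      and_true, and_false, or_false, false_or, if_true, if_false] <;>
    nlinarith [sq_nonneg (1 - k (X 0 ω)), sq_nonneg (0 - k (X 0 ω))]

/-- Near determinism at time `m` implies near determinism at all earlier times. -/
lemma nearDet_of_le {n m : ℕ} (hnm : n ≤ m) {ε : ℝ} {A : Set S} (h : NearDet X P m ε A) :
    NearDet X P n (4 * ε) A := by
  refine (hX.nearDet_of_norm n h.1).mono ?_
  have h1 := hX.norm_sub_le_of_nearDet h
  have h2 := hX.norm_trans_antitone (ind π h.1) hnm
  nlinarith [norm_nonneg (hX.trans 0 m (ind π h.1))]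

/-- A function whose norm is preserved by all `trans 0 n` has deterministic level sets. -/
lemma deterministic_preimage {h : Lp ℝ 2 π} (hh : ∀ n : ℕ, ‖hX.trans 0 n h‖ = ‖h‖) {s : Set ℝ}
    (hs : MeasurableSet s) : Deterministic X P (h ⁻¹' s) := by
  have hm : ∀ f : Lp ℝ 2 π, Measurable f := fun f => (Lp.stronglyMeasurable f).measurable
  refine ⟨hm h hs, fun n => ⟨hX.trans 0 n h ⁻¹' s, hm _ hs, ?_⟩⟩
  have h1 := hX.norm_lift_sub_sq 0 n h
  rw [hh n, sub_self, sq_eq_zero_iff, norm_eq_zero, sub_eq_zero] at h1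
  refine Filter.eventuallyEq_set.2 ?_
  filter_upwards [hX.coeFn_lift n h, h1 ▸ hX.coeFn_lift 0 (hX.trans 0 n h)] with ω h2 h3
  rw [mem_preimage, mem_preimage, mem_preimage, mem_preimage, ← h2, h3]

/-- If all deterministic sets are trivial, nearly deterministic sets become asymptotically
independent of every fixed set: the weak limit of their indicators has deterministic level sets,
hence is constant. -/
lemma exists_asymptotically_independent
    (htriv : ∀ F, Deterministic X P F → π F = 0 ∨ π F = 1) (U : Ultrafilter ℕ)
    (hU : (U : Filter ℕ) ≤ atTop) {A : ℕ → Set S}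
    {ε : ℕ → ℝ} (hε : Tendsto ε atTop (𝓝 0)) (hA : ∀ m : ℕ, NearDet X P m (ε m) (A m)) :
    ∃ p, ∀ Q, MeasurableSet Q → Tendsto (fun m => π.real (A m ∩ Q)) U (𝓝 (p * π.real Q)) := by
  obtain ⟨h, hlim⟩ := exists_weak_limit U (fun m => ind π (hA m).1)
    fun m => norm_ind_le_one (hA m).1
  have hinv : ∀ n : ℕ, hX.trans n 0 (hX.trans 0 n h) = h := by
    intro n
    refine ext_inner_right ℝ fun y => ?_
    have h1 : Tendsto (fun m => ⟪hX.trans n 0 (hX.trans 0 n (ind π (hA m).1)), y⟫) U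
        (𝓝 ⟪hX.trans n 0 (hX.trans 0 n h), y⟫) := by
      have e : ∀ f : Lp ℝ 2 π, ⟪hX.trans n 0 (hX.trans 0 n f), y⟫ =
          ⟪f, hX.trans n 0 (hX.trans 0 n y)⟫ := fun f => by
        rw [inner_trans, real_inner_comm, ← inner_trans, real_inner_comm, inner_trans,
          real_inner_comm, ← inner_trans, real_inner_comm]
      simp_rw [e]
      exact hlim _
    have h2 : Tendsto (fun m => hX.trans n 0 (hX.trans 0 n (ind π (hA m).1)) - ind π (hA m).1)
        atTop (𝓝 0) := by
      rw [tendsto_zero_iff_norm_tendsto_zero]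
      refine squeeze_zero' (Eventually.of_forall fun m => norm_nonneg _) ?_
        (by simpa using hε.sqrt)
      filter_upwards [eventually_ge_atTop n] with m hm
      refine (le_abs_self _).trans (Real.abs_le_sqrt ?_)
      refine (hX.norm_adjoint_sub_sq_le n _).trans (le_trans ?_ (hX.norm_sub_le_of_nearDet (hA m)))
      have := hX.norm_trans_antitone (ind π (hA m).1) hm
      nlinarith [norm_nonneg (hX.trans 0 m (ind π (hA m).1))]
    have h3 := ((h2.mono_left hU).inner (𝕜 := ℝ) (tendsto_const_nhds (x := y)))
    simp only [inner_sub_left, inner_zero_left] at h3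
    have h4 := h1.sub h3
    simp only [sub_sub_cancel, sub_zero] at h4
    exact tendsto_nhds_unique h4 (hlim y)
  have hnorm : ∀ n : ℕ, ‖hX.trans 0 n h‖ = ‖h‖ := fun n =>
    le_antisymm (hX.norm_trans_le _ _ _) (by
      conv_lhs => rw [← hinv n]
      exact hX.norm_trans_le _ _ _)
  obtain ⟨p, hp⟩ := Filter.exists_eventuallyEq_const_of_forall_separating (l := ae π) (f := h)
    MeasurableSet fun s hs => by
      have hd := hX.deterministic_preimage hnorm hs
      rcases htriv _ hd with h0 | h1
      · right
        exact measure_eq_zero_iff_ae_notMem.1 h0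
      · left
        rwa [← prob_compl_eq_zero_iff hd.1] at h1
  refine ⟨p, fun Q hQ => ?_⟩
  have h1 := hlim (ind π hQ)
  simp_rw [inner_ind_ind] at h1
  rw [real_inner_comm, inner_ind_left, integral_congr_ae (ae_restrict_of_ae hp)] at h1
  simpa [mul_comm] using h1

end IsStationaryMarkov

/-- Nearly deterministic sets that are asymptotically independent of every fixed set allow to bisect
the space, so that some nearly deterministic set has measure close to `1 / 2`. -/
lemma exists_nearDet_half (U : Ultrafilter ℕ) {n : ℤ} {p : ℝ} (hp : p ∈ Ioo 0 1) {A : ℕ → Set S}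
    (hA : ∀ ε > 0, ∀ᶠ m in U, NearDet X P n ε (A m))
    (hlim : ∀ Q, MeasurableSet Q → Tendsto (fun m => π.real (A m ∩ Q)) U (𝓝 (p * π.real Q)))
    {ε : ℝ} (hε : 0 < ε) : ∃ B, NearDet X P n ε B ∧ |π.real B - 1 / 2| < ε := by
  obtain ⟨r, hr, hr1⟩ := exists_between (max_lt hp.2 (show 1 - p < 1 by linarith [hp.1]))
  obtain ⟨hr, hr'⟩ := max_lt_iff.1 hr
  have key : ∀ k : ℕ, ∀ δ > 0, ∃ L R, L ⊆ R ∧ NearDet X P n δ L ∧ NearDet X P n δ R ∧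
      π.real L ≤ 1 / 2 ∧ 1 / 2 ≤ π.real R ∧ π.real R - π.real L ≤ r ^ k := by
    intro k
    induction k with
    | zero =>
      intro δ hδ
      refine ⟨∅, univ, empty_subset _, ⟨.empty, ∅, .empty, ?_⟩, ⟨.univ, univ, .univ, ?_⟩, ?_, ?_, ?_⟩
        <;> norm_num [hδ.le]
    | succ k ih =>
      intro δ hδ
      obtain ⟨L, R, hLR, hL, hR, hL2, hR2, hgap⟩ := ih (δ / 3) (by linarith)
      have hRL : π.real (R \ L) = π.real R - π.real L := measureReal_sdiff hLR hL.1
      have hx : ∀ᶠ m in U, (1 - r) * π.real (R \ L) ≤ π.real (A m ∩ (R \ L)) ∧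
          π.real (A m ∩ (R \ L)) ≤ r * π.real (R \ L) := by
        rcases (measureReal_nonneg (μ := π) (s := R \ L)).eq_or_lt with h0 | h0
        · refine Eventually.of_forall fun m => ?_
          have : π.real (A m ∩ (R \ L)) = 0 :=
            le_antisymm (h0 ▸ measureReal_mono inter_subset_right) measureReal_nonneg
          simp [this, ← h0]
        · have h1 := hlim _ (hR.1.diff hL.1)
          filter_upwards [h1.eventually_const_le (show (1 - r) * π.real (R \ L) < _ by nlinarith),
            h1.eventually_le_const (show _ < r * π.real (R \ L) by nlinarith)] with m h2 h3
          exact ⟨h2, h3⟩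
      obtain ⟨m, ⟨hx1, hx2⟩, hm⟩ := (hx.and (hA (δ / 3) (by linarith))).exists
      have hM : NearDet X P n δ (L ∪ R ∩ A m) := (hL.union (hR.inter hm)).mono (by linarith)
      have hMm : π.real (L ∪ R ∩ A m) = π.real L + π.real (A m ∩ (R \ L)) := by
        rw [← measureReal_union _ (hm.1.inter (hR.1.diff hL.1))]
        · congr 1
          ext x
          simp only [mem_union, mem_inter_iff, Set.mem_sdiff]
          tauto
        · exact Set.disjoint_left.2 fun x h1 h2 => h2.2.2 h1
      have hrk : r * (π.real R - π.real L) ≤ r ^ (k + 1) := by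
        rw [pow_succ']
        exact mul_le_mul_of_nonneg_left hgap (by linarith [hp.1])
      rw [hRL] at hx1 hx2
      rcases le_total (π.real (L ∪ R ∩ A m)) (1 / 2) with h | h
      · exact ⟨_, R, union_subset hLR inter_subset_left, hM, hR.mono (by linarith), h, hR2,
          by linarith⟩
      · exact ⟨L, _, subset_union_left, hL.mono (by linarith), hM, hL2, h, by linarith⟩
  obtain ⟨k, hk⟩ := exists_pow_lt_of_lt_one hε hr1
  obtain ⟨L, R, -, hL, -, h1, h2, h3⟩ := key k ε hε
  exact ⟨L, hL, by rw [abs_lt]; constructor <;> linarith⟩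

end Approximation

/-! ### Decay of correlations -/

section Decay

open scoped RealInnerProductSpace symmDiff

namespace IsStationaryMarkov

section General

variable {Ω S : Type*} [MeasurableSpace Ω] [MeasurableSpace S]
  {P : Measure Ω} [IsProbabilityMeasure P] {π : Measure S} [IsProbabilityMeasure π]
  {X : ℤ → Ω → S} (hX : IsStationaryMarkov X P π)
include hX

/-- The squared norms of the iterates of a vector of the unit ball decrease from at most `1`, so
they are almost constant on some long stretch of bounded starting time. -/
lemma exists_slow_stretch (m : ℕ) {ε : ℝ} (hε : 0 < ε) :
    ∃ N : ℕ, ∀ f : Lp ℝ 2 π, ‖f‖ ≤ 1 → ∃ j, j ≤ N ∧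
      ‖hX.trans 0 j f‖ ^ 2 - ‖hX.trans 0 (j + m : ℕ) f‖ ^ 2 ≤ ε := by
  obtain ⟨K, hK⟩ := exists_nat_gt (1 / ε)
  refine ⟨K * m, fun f hf => ?_⟩
  by_contra! hcon
  have h1 : ∀ i ∈ Finset.range K, ε ≤
      ‖hX.trans 0 (i * m : ℕ) f‖ ^ 2 - ‖hX.trans 0 ((i + 1) * m : ℕ) f‖ ^ 2 := fun i hi => by
    have := hcon (i * m) (Nat.mul_le_mul_right m (Finset.mem_range.1 hi).le)
    rw [← Nat.succ_mul] at this
    exact this.le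
  have h2 := Finset.sum_le_sum h1
  rw [Finset.sum_range_sub' (fun i => ‖hX.trans 0 (i * m : ℕ) f‖ ^ 2), Finset.sum_const,
    Finset.card_range, nsmul_eq_mul] at h2
  have h3 : ‖hX.trans 0 (0 * m : ℕ) f‖ ^ 2 ≤ 1 :=
    pow_le_one₀ (norm_nonneg _) ((hX.norm_trans_le _ _ _).trans hf)
  rw [div_lt_iff₀ hε] at hK
  nlinarith [sq_nonneg ‖hX.trans 0 (K * m : ℕ) f‖]

/-- If correlations at lag `n` do not tend to `0` uniformly, there are nearly deterministic sets of
intermediate measure at every time horizon and to every precision. -/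
lemma exists_nearDet_of_correlation {c : ℝ} (hc : 0 < c)
    (hcor : ∀ n : ℕ, ∃ A B, MeasurableSet A ∧ MeasurableSet B ∧
      c ≤ |P.real (X n ⁻¹' A ∩ X 0 ⁻¹' B) - π.real A * π.real B|)
    (m : ℕ) {ε : ℝ} (hε : 0 < ε) :
    ∃ A, NearDet X P m ε A ∧ c ^ 2 / 4 ≤ π.real A ∧ π.real A ≤ 1 - c ^ 2 / 4 := by
  obtain ⟨N, hN⟩ := hX.exists_slow_stretch m (ε := (ε * c ^ 2 / 4) ^ 2) (by positivity)
  obtain ⟨A, B, hA, hB, hAB⟩ := hcor N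
  set f : Lp ℝ 2 π := ind π hA - π.real A • ind π .univ with hf
  have hA1 : π.real A ≤ 1 := measureReal_le_one
  have hA0 : 0 ≤ π.real A := measureReal_nonneg
  have hmean : ⟪f, ind π .univ⟫ = 0 := by
    rw [hf, inner_sub_left, inner_smul_left, inner_ind_ind, inner_ind_ind]
    simp
  have hnorm : ‖f‖ ≤ 1 := by
    have h : ‖f‖ ^ 2 = π.real A - π.real A ^ 2 := by
      have h' : ⟪f, f⟫ = ⟪f, ind π hA⟫ := by
        conv_lhs => rw [hf, inner_sub_right, inner_smul_right, ← hf, hmean]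
        simp
      rw [← real_inner_self_eq_norm_sq, h', hf, inner_sub_left, inner_smul_left, inner_ind_ind,
        inner_ind_ind]
      simp [sq]
    refine (sq_le_one_iff₀ (norm_nonneg _)).1 ?_
    nlinarith
  have hbound : ∀ᵐ x ∂π, |f x| ≤ 1 := by
    filter_upwards [Lp.coeFn_sub (ind π hA) (π.real A • ind π .univ),
      Lp.coeFn_smul (π.real A) (ind π .univ), coeFn_ind π hA, coeFn_ind π .univ] with x h1 h2 h3 h4
    rw [hf, h1, Pi.sub_apply, h2, Pi.smul_apply, h3, h4, abs_le]
    by_cases hx : x ∈ A <;> simp [hx] <;> linarith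
  have hlow : c ≤ ‖hX.trans 0 N f‖ := by
    have h1 : ⟪hX.trans 0 N f, ind π hB⟫ =
        P.real (X N ⁻¹' A ∩ X 0 ⁻¹' B) - π.real A * π.real B := by
      rw [hf, map_sub, map_smul, trans_univ, inner_sub_left, inner_smul_left, inner_trans_ind,
        inner_ind_ind]
      simp
    rw [← h1] at hAB
    refine hAB.trans ((abs_real_inner_le_norm _ _).trans ?_)
    exact mul_le_of_le_one_right (norm_nonneg _) (norm_ind_le_one hB)
  obtain ⟨j, hj, hle⟩ := hN f hnorm
  have hg : c ^ 2 ≤ ‖hX.trans 0 j f‖ ^ 2 :=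
    pow_le_pow_left₀ hc.le (hlow.trans (hX.norm_trans_antitone f hj)) 2
  obtain ⟨E, hE, h1, h2⟩ := hX.exists_nearDet_of_norm (hX.trans_le_one 0 j hbound)
    ((hX.inner_trans_univ 0 j f).trans hmean) (by positivity) hg m
  refine ⟨E, hE.mono ?_, h1, h2⟩
  rw [add_comm j m, hX.trans_comp m j, ContinuousLinearMap.comp_apply] at hle
  calc 4 / c ^ 2 * √(‖hX.trans 0 j f‖ ^ 2 - ‖hX.trans 0 m (hX.trans 0 j f)‖ ^ 2)
      ≤ 4 / c ^ 2 * (ε * c ^ 2 / 4) := by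
        refine mul_le_mul_of_nonneg_left ?_ (by positivity)
        exact Real.sqrt_le_iff.2 ⟨by positivity, hle⟩
    _ = ε := by field_simp

end General

variable {Ω : Type*} [MeasurableSpace Ω] {P : Measure Ω} [IsProbabilityMeasure P]
  {π : Measure ℝ} [IsProbabilityMeasure π] {X : ℤ → Ω → ℝ} (hX : IsStationaryMarkov X P π)
include hX

/-- For an ergodic aperiodic stationary Markov chain, correlations decay uniformly as soon as, at
some lag `s`, no set of measure close to `1 / 2` is nearly deterministic. -/
theorem exists_small_correlation
    (herg : ∀ W : Set ℝ, MeasurableSet W → X 1 ⁻¹' W =ᵐ[P] X 0 ⁻¹' W → π W = 0 ∨ π W = 1)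
    (haper : IsAperiodicChain X P)
    {s : ℕ} {ε : ℝ} (hε : 0 < ε) (hbal : ∀ A, NearDet X P s ε A → ε ≤ |π.real A - 1 / 2|)
    {c : ℝ} (hc : 0 < c) :
    ∃ n : ℕ, ∀ A B, MeasurableSet A → MeasurableSet B →
      |P.real (X n ⁻¹' A ∩ X 0 ⁻¹' B) - π.real A * π.real B| < c := by
  by_contra! hcor
  choose A hA h1 h2 using fun m : ℕ => hX.exists_nearDet_of_correlation hc
    (fun n => by simpa [and_assoc] using hcor n) m (ε := 1 / (m + 1)) (by positivity)
  have hlim0 := tendsto_one_div_add_atTop_nhds_zero_nat (𝕜 := ℝ)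
  set U : Ultrafilter ℕ := hyperfilter ℕ with hU
  have hUle : (U : Filter ℕ) ≤ atTop := Nat.hyperfilter_le_atTop
  obtain ⟨p, hp⟩ := hX.exists_asymptotically_independent
    (fun F hF => hX.deterministic_trivial herg haper hε hbal hF) U hUle hlim0 hA
  have hp1 := hp univ .univ
  simp only [inter_univ, probReal_univ, mul_one] at hp1
  have hpl : c ^ 2 / 4 ≤ p := ge_of_tendsto hp1 (Eventually.of_forall h1)
  have hpu : p ≤ 1 - c ^ 2 / 4 := le_of_tendsto hp1 (Eventually.of_forall h2)
  have hc2 : 0 < c ^ 2 := by positivity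
  have hnear : ∀ δ > 0, ∀ᶠ m in U, NearDet X P s δ (A m) := fun δ hδ => by
    have h := (hlim0.eventually_le_const (show 0 < δ / 4 by linarith)).and (eventually_ge_atTop s)
    filter_upwards [h.filter_mono hUle] with m hm
    exact (hX.nearDet_of_le hm.2 (hA m)).mono (by linarith [hm.1])
  obtain ⟨B, hB, hlt⟩ := exists_nearDet_half U ⟨by linarith, by linarith⟩ hnear hp hε
  exact absurd (hbal B hB) (not_le.2 hlt)

end IsStationaryMarkov

end Decay

/-! ### Copulas as laws of random vectors -/

/-- Every strong mixing coefficient is at most `1 / 4`. -/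
lemma abs_measureReal_inter_sub_le {Ω : Type*} [MeasurableSpace Ω] (μ : Measure Ω)
    [IsProbabilityMeasure μ] {A B : Set Ω} (hB : MeasurableSet B) :
    |μ.real (A ∩ B) - μ.real A * μ.real B| ≤ 1 / 4 := by
  have h1 : μ.real (A ∩ B) ≤ μ.real A := measureReal_mono inter_subset_left
  have h2 : μ.real (A ∩ B) ≤ μ.real B := measureReal_mono inter_subset_right
  have h3 : 0 ≤ μ.real (A ∩ B) := measureReal_nonneg
  have h4 := measureReal_union_add_inter (μ := μ) (s := A) hB
  have h5 : μ.real (A ∪ B) ≤ 1 := measureReal_le_one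
  have h6 : μ.real A ≤ 1 := measureReal_le_one
  have h7 : μ.real B ≤ 1 := measureReal_le_one
  set x := μ.real (A ∩ B)
  set a := μ.real A
  set b := μ.real B
  rw [abs_le]
  constructor
  · rcases le_total (a + b) 1 with h | h
    · nlinarith [sq_nonneg (a - b), sq_nonneg (a + b)]
    · nlinarith [sq_nonneg (a - b), mul_nonneg (sub_nonneg.2 h) (show 0 ≤ 3 - a - b by linarith)]
  · nlinarith [sq_nonneg (x - 1 / 2), mul_nonneg (sub_nonneg.2 h1) (sub_nonneg.2 h2),
      mul_nonneg h3 (sub_nonneg.2 h1), mul_nonneg h3 (sub_nonneg.2 h2)]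

lemma measureReal_ofReal_smul_add {Ω : Type*} [MeasurableSpace Ω] (μ ν : Measure Ω)
    [IsFiniteMeasure μ] [IsFiniteMeasure ν] {a b : ℝ} (ha : 0 ≤ a) (hb : 0 ≤ b) (s : Set Ω) :
    (ENNReal.ofReal a • μ + ENNReal.ofReal b • ν).real s = a * μ.real s + b * ν.real s := by
  rw [measureReal_def, Measure.add_apply, Measure.smul_apply, Measure.smul_apply, smul_eq_mul,
    smul_eq_mul, ENNReal.toReal_add (ENNReal.mul_ne_top ENNReal.ofReal_ne_top (measure_ne_top _ _))
      (ENNReal.mul_ne_top ENNReal.ofReal_ne_top (measure_ne_top _ _)), ENNReal.toReal_mul,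
    ENNReal.toReal_mul, ENNReal.toReal_ofReal ha, ENNReal.toReal_ofReal hb]
  rfl

namespace Copula

/-- A law on the plane whose distribution function is a copula is concentrated on the unit
square. -/
lemma ae_mem_square (C : Copula) {μ : Measure (ℝ × ℝ)} [IsProbabilityMeasure μ]
    (h : ∀ u ∈ Icc (0 : ℝ) 1, ∀ v ∈ Icc (0 : ℝ) 1, μ.real (Iic u ×ˢ Iic v) = C u v) :
    ∀ᵐ z ∂μ, z.1 ∈ Ioc (0 : ℝ) 1 ∧ z.2 ∈ Ioc (0 : ℝ) 1 := by
  have i0 : (0 : ℝ) ∈ Icc (0 : ℝ) 1 := by simp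
  have i1 : (1 : ℝ) ∈ Icc (0 : ℝ) 1 := by simp
  have h11 : ∀ᵐ z ∂μ, z ∈ Iic (1 : ℝ) ×ˢ Iic (1 : ℝ) := by
    have e := h 1 i1 1 i1
    rw [C.one_left 1 i1, measureReal_def, ENNReal.toReal_eq_one_iff] at e
    rwa [← prob_compl_eq_zero_iff (measurableSet_Iic.prod measurableSet_Iic)] at e
  have h01 : ∀ᵐ z ∂μ, z ∉ Iic (0 : ℝ) ×ˢ Iic (1 : ℝ) := by
    have e := h 0 i0 1 i1
    rw [C.zero_left 1 i1, measureReal_eq_zero_iff] at e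
    exact measure_eq_zero_iff_ae_notMem.1 e
  have h10 : ∀ᵐ z ∂μ, z ∉ Iic (1 : ℝ) ×ˢ Iic (0 : ℝ) := by
    have e := h 1 i1 0 i0
    rw [C.zero_right 1 i1, measureReal_eq_zero_iff] at e
    exact measure_eq_zero_iff_ae_notMem.1 e
  filter_upwards [h11, h01, h10] with z h1 h2 h3
  simp only [mem_prod, mem_Iic] at h1 h2 h3
  refine ⟨⟨?_, h1.1⟩, ?_, h1.2⟩ <;> by_contra! h4
  exacts [h2 ⟨h4, h1.2⟩, h3 ⟨h1.1, h4⟩]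

lemma measureReal_Iic_prod_Iic_clamp (C : Copula) {μ : Measure (ℝ × ℝ)} [IsProbabilityMeasure μ]
    (h : ∀ u ∈ Icc (0 : ℝ) 1, ∀ v ∈ Icc (0 : ℝ) 1, μ.real (Iic u ×ˢ Iic v) = C u v) (u v : ℝ) :
    μ.real (Iic u ×ˢ Iic v) = C (max 0 (min 1 u)) (max 0 (min 1 v)) := by
  rw [← h _ (clamp_mem u) _ (clamp_mem v)]
  refine measureReal_congr (Filter.eventuallyEq_set.2 ?_)
  have key : ∀ x w : ℝ, x ∈ Ioc (0 : ℝ) 1 → (x ≤ w ↔ x ≤ max 0 (min 1 w)) := fun x w hx => by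
    rw [le_max_iff, le_min_iff]
    exact ⟨fun h => Or.inr ⟨hx.2, h⟩, fun h => (h.resolve_left (not_le.2 hx.1)).2⟩
  filter_upwards [C.ae_mem_square h] with z hz
  simp only [mem_prod, mem_Iic]
  rw [key _ u hz.1, key _ v hz.2]

/-- The law `C.measure` is the only one whose distribution function on the unit square is `C`. -/
lemma eq_measure (C : Copula) {μ : Measure (ℝ × ℝ)} [IsProbabilityMeasure μ]
    (h : ∀ u ∈ Icc (0 : ℝ) 1, ∀ v ∈ Icc (0 : ℝ) 1, μ.real (Iic u ×ˢ Iic v) = C u v) :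
    μ = C.measure := by
  have hspan : IsCountablySpanning (range (Iic : ℝ → Set ℝ)) :=
    ⟨fun n : ℕ => Iic (n : ℝ), fun n => ⟨n, rfl⟩, by
      refine eq_univ_of_forall fun x => ?_
      obtain ⟨n, hn⟩ := exists_nat_ge x
      exact mem_iUnion.2 ⟨n, hn⟩⟩
  have hgen : MeasurableSpace.generateFrom (range (Iic : ℝ → Set ℝ)) =
      (inferInstance : MeasurableSpace ℝ) := by
    rw [← borel_eq_generateFrom_Iic]
    exact (BorelSpace.measurable_eq (α := ℝ)).symm
  refine ext_of_generate_finite _ (generateFrom_eq_prod hgen hgen hspan hspan).symm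
    ((isPiSystem_Iic).prod isPiSystem_Iic) ?_ (by simp)
  rintro _ ⟨_, ⟨u, rfl⟩, _, ⟨v, rfl⟩, rfl⟩
  rw [← measureReal_eq_measureReal_iff, C.measureReal_Iic_prod_Iic_clamp h,
    C.measureReal_Iic_prod_Iic_clamp fun u hu v hv => C.measure_Iic_prod_Iic hu hv]

lemma fst_measure (C : Copula) : C.measure.fst = (volume : Measure ℝ).restrict (Icc 0 1) := by
  rw [measure, Measure.fst_compProd]

lemma map_swap_measure (C : Copula) : C.measure.map Prod.swap = C.transpose.measure := by
  have : IsProbabilityMeasure (C.measure.map Prod.swap) :=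
    Measure.isProbabilityMeasure_map measurable_swap.aemeasurable
  refine eq_measure _ fun u hu v hv => ?_
  rw [map_measureReal_apply measurable_swap (measurableSet_Iic.prod measurableSet_Iic),
    preimage_swap_prod]
  exact C.measure_Iic_prod_Iic hv hu

lemma snd_measure (C : Copula) : C.measure.snd = (volume : Measure ℝ).restrict (Icc 0 1) := by
  rw [← C.transpose.fst_measure, ← map_swap_measure, Measure.fst_map_swap]

lemma measureReal_prod_univ (C : Copula) {A : Set ℝ} (hA : MeasurableSet A) :
    C.measure.real (A ×ˢ univ) = ((volume : Measure ℝ).restrict (Icc 0 1)).real A := by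
  rw [← C.fst_measure, measureReal_def, measureReal_def, Measure.fst_apply hA, prod_univ]

lemma measureReal_univ_prod (C : Copula) {A : Set ℝ} (hA : MeasurableSet A) :
    C.measure.real (univ ×ˢ A) = ((volume : Measure ℝ).restrict (Icc 0 1)).real A := by
  rw [← C.snd_measure, measureReal_def, measureReal_def, Measure.snd_apply hA, univ_prod]

lemma abs_measure_sub_le_quarter (C : Copula) {A B : Set ℝ} (hA : MeasurableSet A)
    (hB : MeasurableSet B) :
    |C.measure.real (A ×ˢ B) - ((volume : Measure ℝ).restrict (Icc 0 1)).real A *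
      ((volume : Measure ℝ).restrict (Icc 0 1)).real B| ≤ 1 / 4 := by
  have h := abs_measureReal_inter_sub_le C.measure (A := A ×ˢ univ) (MeasurableSet.univ.prod hB)
  rwa [C.measureReal_prod_univ hA, C.measureReal_univ_prod hB, prod_inter_prod, inter_univ,
    univ_inter] at h

lemma unif_real_of_subset {A : Set ℝ} (h : A ⊆ Icc 0 1) :
    ((volume : Measure ℝ).restrict (Icc 0 1)).real A = (volume : Measure ℝ).real A := by
  rw [measureReal_def, Measure.restrict_eq_self _ h, measureReal_def]

lemma abs_measure_sub_le_alpha (C : Copula) {A B : Set ℝ} (hA : MeasurableSet A)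
    (hB : MeasurableSet B) :
    |C.measure.real (A ×ˢ B) - ((volume : Measure ℝ).restrict (Icc 0 1)).real A *
      ((volume : Measure ℝ).restrict (Icc 0 1)).real B| ≤ C.alpha := by
  have hbdd : BddAbove {r : ℝ | ∃ A B : Set ℝ, MeasurableSet A ∧ MeasurableSet B ∧
      A ⊆ Icc 0 1 ∧ B ⊆ Icc 0 1 ∧ r = |C.measure.real (A ×ˢ B) -
        (volume : Measure ℝ).real A * (volume : Measure ℝ).real B|} := by
    refine ⟨1 / 4, ?_⟩
    rintro _ ⟨A, B, hA, hB, hA1, hB1, rfl⟩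
    have := C.abs_measure_sub_le_quarter hA hB
    rwa [unif_real_of_subset hA1, unif_real_of_subset hB1] at this
  refine le_csSup hbdd ⟨A ∩ Icc 0 1, B ∩ Icc 0 1, hA.inter measurableSet_Icc,
    hB.inter measurableSet_Icc, inter_subset_right, inter_subset_right, ?_⟩
  have hsq := C.ae_mem_square (μ := C.measure) fun u hu v hv => C.measure_Iic_prod_Iic hu hv
  have h1 : C.measure.real (A ×ˢ B) = C.measure.real ((A ∩ Icc 0 1) ×ˢ (B ∩ Icc 0 1)) := by
    refine measureReal_congr (Filter.eventuallyEq_set.2 ?_)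
    filter_upwards [hsq] with z hz
    simp [Ioc_subset_Icc_self hz.1, Ioc_subset_Icc_self hz.2, -mem_Icc]
  rw [h1, measureReal_restrict_apply hA, measureReal_restrict_apply hB]

lemma alpha_le (C : Copula) {r : ℝ} (h : ∀ A B : Set ℝ, MeasurableSet A → MeasurableSet B →
    |C.measure.real (A ×ˢ B) - ((volume : Measure ℝ).restrict (Icc 0 1)).real A *
      ((volume : Measure ℝ).restrict (Icc 0 1)).real B| ≤ r) : C.alpha ≤ r := by
  refine csSup_le ⟨_, ∅, ∅, .empty, .empty, empty_subset _, empty_subset _, rfl⟩ ?_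
  rintro _ ⟨A, B, hA, hB, hA1, hB1, rfl⟩
  have := h A B hA hB
  rwa [unif_real_of_subset hA1, unif_real_of_subset hB1] at this

/-! ### Copulas that contain a multiple of another copula -/

/-- `E` dominates `w D`: the law of `E` gives every rectangle at least `w` times the mass that the
law of `D` gives it. -/
def Dominates (w : ℝ) (E D : Copula) : Prop :=
  ∀ a b c d : ℝ, 0 ≤ a → a ≤ b → b ≤ 1 → 0 ≤ c → c ≤ d → d ≤ 1 →
    w * (D a c + D b d - D a d - D b c) ≤ E a c + E b d - E a d - E b c

/-- The copula `R` with `E = w D + (1 - w) R`. -/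
noncomputable def residual {w : ℝ} (hw : w < 1) {E D : Copula} (h : Dominates w E D) : Copula where
  toFun x y := (E x y - w * D x y) / (1 - w)
  zero_left x hx := by rw [E.zero_left x hx, D.zero_left x hx]; simp
  zero_right x hx := by rw [E.zero_right x hx, D.zero_right x hx]; simp
  one_left x hx := by
    have : 1 - w ≠ 0 := by linarith
    rw [E.one_left x hx, D.one_left x hx]
    field_simp
  one_right x hx := by
    have : 1 - w ≠ 0 := by linarith
    rw [E.one_right x hx, D.one_right x hx]
    field_simp
  rect_nonneg a b c d h1 h2 h3 h4 h5 h6 := by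
    rw [← add_div, ← sub_div, ← sub_div]
    refine div_nonneg ?_ (by linarith)
    linarith [h a b c d h1 h2 h3 h4 h5 h6]

lemma measure_eq_add_residual {w : ℝ} (hw0 : 0 ≤ w) (hw : w < 1) {E D : Copula}
    (h : Dominates w E D) :
    E.measure = ENNReal.ofReal w • D.measure +
      ENNReal.ofReal (1 - w) • (residual hw h).measure := by
  have hw' : 0 ≤ 1 - w := by linarith
  set μ := ENNReal.ofReal w • D.measure + ENNReal.ofReal (1 - w) • (residual hw h).measure
  have : IsProbabilityMeasure μ := ⟨by simp [μ, ← ENNReal.ofReal_add hw0 hw']⟩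
  refine (E.eq_measure fun u hu v hv => ?_).symm
  rw [measureReal_ofReal_smul_add _ _ hw0 hw', measure_Iic_prod_Iic _ hu hv,
    measure_Iic_prod_Iic _ hu hv, residual]
  have : 1 - w ≠ 0 := by linarith
  field_simp
  ring

/-- The coefficient `α` is convex and never exceeds `1 / 4`. -/
lemma alpha_le_of_dominates {w : ℝ} (hw0 : 0 ≤ w) (hw : w < 1) {E D : Copula}
    (h : Dominates w E D) : E.alpha ≤ w * D.alpha + (1 - w) * (1 / 4) := by
  have hw' : 0 ≤ 1 - w := by linarith
  refine E.alpha_le fun A B hA hB => ?_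
  rw [measure_eq_add_residual hw0 hw h, measureReal_ofReal_smul_add _ _ hw0 hw']
  have h1 := D.abs_measure_sub_le_alpha hA hB
  have h2 := (residual hw h).abs_measure_sub_le_quarter hA hB
  rw [abs_le] at h1 h2 ⊢
  constructor <;> nlinarith

/-- Domination passes to the partial derivatives. -/
lemma Dominates.d1_le {w : ℝ} {E D : Copula} (h : Dominates w E D) {y y' : ℝ} (hy : 0 ≤ y)
    (hyy : y ≤ y') (hy' : y' ≤ 1) : ∀ᵐ x ∂(volume.restrict (Icc (0 : ℝ) 1)),
      w * (D.d1 x y' - D.d1 x y) ≤ E.d1 x y' - E.d1 x y := by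
  have i1 : y ∈ Icc (0 : ℝ) 1 := ⟨hy, hyy.trans hy'⟩
  have i2 : y' ∈ Icc (0 : ℝ) 1 := ⟨hy.trans hyy, hy'⟩
  have hmono : MonotoneOn (fun s => (E s y' - E s y) - w * (D s y' - D s y)) (Icc 0 1) := by
    intro a ha b hb hab
    have := h a b y y' ha.1 hab hb.2 hy hyy hy'
    dsimp only
    linarith
  filter_upwards [E.ae_differentiableAt_left i1, E.ae_differentiableAt_left i2,
    D.ae_differentiableAt_left i1, D.ae_differentiableAt_left i2, ae_mem_Ioo] with x e1 e2 d1 d2 hx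
  have h3 := (hmono.mono Ioo_subset_Icc_self).derivWithin_nonneg (x := x)
  rw [derivWithin_of_isOpen isOpen_Ioo hx] at h3
  have h4 : HasDerivAt (fun s => (E s y' - E s y) - w * (D s y' - D s y))
      ((E.d1 x y' - E.d1 x y) - w * (D.d1 x y' - D.d1 x y)) x :=
    (e2.hasDerivAt.sub e1.hasDerivAt).sub ((d2.hasDerivAt.sub d1.hasDerivAt).const_mul w)
  rw [h4.deriv] at h3
  linarith

lemma Dominates.transpose {w : ℝ} {E D : Copula} (h : Dominates w E D) :
    Dominates w E.transpose D.transpose := by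
  intro a b c d h1 h2 h3 h4 h5 h6
  have := h c d a b h4 h5 h6 h1 h2 h3
  change w * (D c a + D d b - D d a - D c b) ≤ E c a + E d b - E d a - E c b
  linarith

/-- The mass of a rectangle under the fold product. -/
lemma fold_rect (A B : Copula) {a b c d : ℝ} (ha : a ∈ Icc (0 : ℝ) 1) (hb : b ∈ Icc (0 : ℝ) 1)
    (hc : c ∈ Icc (0 : ℝ) 1) (hd : d ∈ Icc (0 : ℝ) 1) :
    Integrable (fun t => (A.d2 b t - A.d2 a t) * (B.d1 t d - B.d1 t c))
      (volume.restrict (Icc (0 : ℝ) 1)) ∧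
    fold A B a c + fold A B b d - fold A B a d - fold A B b c =
      ∫ t in Icc (0 : ℝ) 1, (A.d2 b t - A.d2 a t) * (B.d1 t d - B.d1 t c) := by
  have i1 := A.integrable_d2_mul_d1 B ha hc
  have i2 := A.integrable_d2_mul_d1 B hb hd
  have i3 := A.integrable_d2_mul_d1 B ha hd
  have i4 := A.integrable_d2_mul_d1 B hb hc
  have e : (fun t => (A.d2 b t - A.d2 a t) * (B.d1 t d - B.d1 t c)) = fun t =>
      A.d2 a t * B.d1 t c + A.d2 b t * B.d1 t d - A.d2 a t * B.d1 t d - A.d2 b t * B.d1 t c := by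
    ext t; ring
  have i12 : Integrable (fun t => A.d2 a t * B.d1 t c + A.d2 b t * B.d1 t d)
      (volume.restrict (Icc (0 : ℝ) 1)) := i1.add i2
  have i123 : Integrable (fun t => A.d2 a t * B.d1 t c + A.d2 b t * B.d1 t d
      - A.d2 a t * B.d1 t d) (volume.restrict (Icc (0 : ℝ) 1)) := i12.sub i3
  rw [e]
  refine ⟨i123.sub i4, ?_⟩
  rw [integral_sub i123 i4, integral_sub i12 i3, integral_add i1 i2]
  simp only [integral_Icc_eq]
  rfl

lemma Dominates.fold {w w' : ℝ} (hw : 0 ≤ w) (hw' : 0 ≤ w') {E D E' D' : Copula}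
    (h : Dominates w E D) (h' : Dominates w' E' D') :
    Dominates (w * w') (E.fold E') (D.fold D') := by
  intro a b c d ha hab hb hc hcd hd
  have ia : a ∈ Icc (0 : ℝ) 1 := ⟨ha, hab.trans hb⟩
  have ib : b ∈ Icc (0 : ℝ) 1 := ⟨ha.trans hab, hb⟩
  have ic : c ∈ Icc (0 : ℝ) 1 := ⟨hc, hcd.trans hd⟩
  have id : d ∈ Icc (0 : ℝ) 1 := ⟨hc.trans hcd, hd⟩
  obtain ⟨i1, e1⟩ := D.fold_rect D' ia ib ic id
  obtain ⟨i2, e2⟩ := E.fold_rect E' ia ib ic id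
  rw [e1, e2, ← integral_const_mul]
  refine integral_mono_ae (i1.const_mul _) i2 ?_
  filter_upwards [h.transpose.d1_le ha hab hb, h'.d1_le hc hcd hd,
    D.transpose.d1_mono ha hab hb, D'.d1_mono hc hcd hd] with t h1 h2 h3 h4
  simp only [d1_transpose] at h1 h3
  have p1 := mul_nonneg hw (sub_nonneg.2 h3)
  have p2 := mul_nonneg hw' (sub_nonneg.2 h4)
  calc w * w' * ((D.d2 b t - D.d2 a t) * (D'.d1 t d - D'.d1 t c))
      = (w * (D.d2 b t - D.d2 a t)) * (w' * (D'.d1 t d - D'.d1 t c)) := by ring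
    _ ≤ (E.d2 b t - E.d2 a t) * (E'.d1 t d - E'.d1 t c) :=
        mul_le_mul h1 h2 p2 (p1.trans h1)

lemma dominates_foldProd : ∀ (n : ℕ) {w : Fin n → ℝ} {E D : Fin n → Copula}, (∀ i, 0 ≤ w i) →
    (∀ i, Dominates (w i) (E i) (D i)) → Dominates (∏ i, w i) (foldProd n E) (foldProd n D)
  | 0, w, E, D, _, _ => fun a b c d _ _ _ _ _ _ => by simp [foldProd]
  | 1, w, E, D, _, h => by simpa [foldProd] using h 0
  | n + 2, w, E, D, hw, h => by
    rw [Fin.prod_univ_castSucc]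
    exact (dominates_foldProd (n + 1) (fun i => hw i.castSucc) fun i => h i.castSucc).fold
      (Finset.prod_nonneg fun i _ => hw _) (hw _) (h _)

lemma dominates_convexComb {k : ℕ} (a : Fin k → ℝ) (C : Fin k → Copula) (ha : ∀ i, 0 ≤ a i)
    (hsum : ∑ i, a i = 1) (i : Fin k) : Dominates (a i) (convexComb a C ha hsum) (C i) := by
  intro p q r s h1 h2 h3 h4 h5 h6
  simp only [convexComb, ← Finset.sum_add_distrib, ← Finset.sum_sub_distrib, ← mul_add, ← mul_sub]
  exact Finset.single_le_sum (f := fun i => a i * (C i p r + C i q s - C i p s - C i q r))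
    (fun j _ => mul_nonneg (ha j) ((C j).rect_nonneg p q r s h1 h2 h3 h4 h5 h6))
    (Finset.mem_univ i)

/-- A power of a convex combination of copulas contains a multiple of each product of the
components, so that its coefficient `α` is below `1 / 4` if that of such a product is. -/
lemma alphaN_convexComb_lt {k : ℕ} (C : Fin k → Copula) (a : Fin k → ℝ)
    (ha : ∀ i, a i ∈ Ioo (0 : ℝ) 1) (hsum : ∑ i, a i = 1) (s : ℕ) (hs : 1 ≤ s) (j : Fin s → Fin k)
    (hα : (foldProd s fun l => C (j l)).alpha < 1 / 4) :
    (convexComb a C (fun i => (ha i).1.le) hsum).alphaN s < 1 / 4 := by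
  have hw0 : 0 < ∏ l, a (j l) := Finset.prod_pos fun l _ => (ha _).1
  have hw1 : ∏ l, a (j l) < 1 := by
    have hne : (Finset.univ : Finset (Fin s)).Nonempty := ⟨⟨0, hs⟩, Finset.mem_univ _⟩
    have := Finset.prod_lt_prod_of_nonempty (f := fun l => a (j l)) (g := fun _ => 1)
      (fun l _ => (ha _).1) (fun l _ => (ha _).2) hne
    simpa using this
  have h := alpha_le_of_dominates hw0.le hw1 (dominates_foldProd s (fun l => (ha (j l)).1.le)
    fun l => dominates_convexComb a C (fun i => (ha i).1.le) hsum (j l))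
  refine lt_of_le_of_lt h ?_
  nlinarith

end Copula

/-! ### The Markov property for the whole future -/

section MarkovProperty

variable {Ω : Type*} {m : MeasurableSpace Ω} [mΩ : MeasurableSpace Ω] {P : Measure Ω} [IsProbabilityMeasure P]

lemma condExp_eq_zero_iff (hm : m ≤ mΩ) {Z : Ω → ℝ} (hZ : Integrable Z P) :
    P[Z | m] =ᵐ[P] 0 ↔ ∀ s, MeasurableSet[m] s → ∫ ω in s, Z ω ∂P = 0 := by
  constructor
  · intro h s hs
    rw [← setIntegral_condExp hm hZ hs, integral_congr_ae (ae_restrict_of_ae h)]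
    simp
  · intro h
    refine (ae_eq_condExp_of_forall_setIntegral_eq hm hZ
      (fun _ _ _ => (integrable_zero _ _ _).integrableOn) ?_
      aestronglyMeasurable_zero).symm
    intro s hs _
    simp [h s hs]

lemma sigmaOf_le {X : ℤ → Ω → ℝ} (hX : ∀ n, Measurable (X n)) (T : Set ℤ) : sigmaOf X T ≤ mΩ :=
  iSup₂_le fun n _ => (hX n).comap_le

lemma sigmaOf_mono (X : ℤ → Ω → ℝ) {T T' : Set ℤ} (h : T ⊆ T') : sigmaOf X T ≤ sigmaOf X T' :=
  biSup_mono h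

lemma sigmaOf_singleton (X : ℤ → Ω → ℝ) (n : ℤ) :
    sigmaOf X {n} = MeasurableSpace.comap (X n) inferInstance := iSup_singleton

lemma comap_le_sigmaOf (X : ℤ → Ω → ℝ) {n : ℤ} {T : Set ℤ} (h : n ∈ T) :
    MeasurableSpace.comap (X n) inferInstance ≤ sigmaOf X T :=
  le_iSup₂_of_le n h le_rfl

lemma integrable_indicator_one {A : Set Ω} (hA : MeasurableSet A) :
    Integrable (A.indicator fun _ => (1 : ℝ)) P := (integrable_const 1).indicator hA

lemma condExp_indicator_mem {A : Set Ω} (hA : MeasurableSet A) :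
    ∀ᵐ ω ∂P, (P⟦A | m⟧) ω ∈ Icc (0 : ℝ) 1 := by
  by_cases hm : m ≤ mΩ
  · have h0 : 0 ≤ᵐ[P] P⟦A | m⟧ :=
      condExp_nonneg (Eventually.of_forall fun ω => indicator_nonneg (fun _ _ => zero_le_one) ω)
    have h1 : P⟦A | m⟧ ≤ᵐ[P] P[fun _ => (1 : ℝ) | m] :=
      condExp_mono (integrable_indicator_one hA) (integrable_const _)
        (Eventually.of_forall fun ω => indicator_le_self' (fun _ _ => zero_le_one) ω)
    rw [condExp_const hm] at h1
    filter_upwards [h0, h1] with ω a b using ⟨a, b⟩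
  · rw [condExp_of_not_le hm]
    simp

namespace IsMarkovChain

variable {X : ℤ → Ω → ℝ} (hX : IsMarkovChain X P)
include hX

/-- A variable of the past that is orthogonal to the present is orthogonal to the next state. -/
lemma condExp_succ_eq_zero {n : ℤ} {Z : Ω → ℝ} (hZm : StronglyMeasurable[sigmaOf X (Iic n)] Z)
    (hZ : Integrable Z P) (h0 : P[Z | MeasurableSpace.comap (X n) inferInstance] =ᵐ[P] 0) :
    P[Z | MeasurableSpace.comap (X (n + 1)) inferInstance] =ᵐ[P] 0 := by
  have hF := sigmaOf_le hX.measurable (Iic n)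
  have hn : MeasurableSpace.comap (X n) inferInstance ≤ mΩ := (hX.measurable n).comap_le
  refine (condExp_eq_zero_iff (hX.measurable _).comap_le hZ).2 ?_
  rintro _ ⟨B, hB, rfl⟩
  have hB' := hX.measurable (n + 1) hB
  set ψ : Ω → ℝ := (X (n + 1) ⁻¹' B).indicator fun _ => (1 : ℝ) with hψ
  have hψi : Integrable ψ P := integrable_indicator_one hB'
  have hbdd : ∀ η : Ω → ℝ, AEStronglyMeasurable η P → (∀ᵐ ω ∂P, η ω ∈ Icc (0 : ℝ) 1) →
      Integrable (Z * η) P := fun η hη h => by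
    refine hZ.mul_bdd (c := 1) hη ?_
    filter_upwards [h] with ω hω
    rw [Real.norm_eq_abs, abs_of_nonneg hω.1]
    exact hω.2
  have hψ1 : ∀ ω, ψ ω ∈ Icc (0 : ℝ) 1 := fun ω => by
    by_cases h : ω ∈ X (n + 1) ⁻¹' B <;> simp [hψ, h]
  have hZψ : Integrable (Z * ψ) P := hbdd ψ hψi.aestronglyMeasurable (Eventually.of_forall hψ1)
  have hmk := hX.markov n B hB
  rw [sigmaOf_singleton] at hmk
  set η := P[ψ | MeasurableSpace.comap (X n) inferInstance] with hη
  have hZη : Integrable (Z * η) P :=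
    hbdd η integrable_condExp.aestronglyMeasurable (condExp_indicator_mem hB')
  calc ∫ ω in X (n + 1) ⁻¹' B, Z ω ∂P = ∫ ω, (Z * ψ) ω ∂P := by
        rw [← integral_indicator hB']
        refine integral_congr_ae (Eventually.of_forall fun ω => ?_)
        by_cases h : ω ∈ X (n + 1) ⁻¹' B <;> simp [hψ, h]
    _ = ∫ ω, (P[Z * ψ | sigmaOf X (Iic n)]) ω ∂P := (integral_condExp hF).symm
    _ = ∫ ω, (Z * η) ω ∂P := by
        refine integral_congr_ae ?_
        filter_upwards [condExp_mul_of_stronglyMeasurable_left hZm hZψ hψi, hmk] with ω h1 h2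
        rw [h1, Pi.mul_apply, Pi.mul_apply, h2]
    _ = ∫ ω, (P[Z * η | MeasurableSpace.comap (X n) inferInstance]) ω ∂P :=
        (integral_condExp hn).symm
    _ = 0 := by
        refine integral_eq_zero_of_ae ?_
        filter_upwards [condExp_mul_of_stronglyMeasurable_right
          (stronglyMeasurable_condExp (f := ψ)) hZη hZ, h0] with ω h1 h2
        rw [h1, Pi.mul_apply, h2]
        simp

/-- A variable of the past that is orthogonal to the present is orthogonal to every cylinder event
of the future. -/
lemma setIntegral_cylinder_eq_zero (k : ℕ) : ∀ {n : ℤ} {Z : Ω → ℝ} {B : ℕ → Set ℝ},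
    StronglyMeasurable[sigmaOf X (Iic n)] Z → Integrable Z P →
    P[Z | MeasurableSpace.comap (X n) inferInstance] =ᵐ[P] 0 → (∀ i, MeasurableSet (B i)) →
    ∫ ω in {ω | ∀ i < k, X (n + i) ω ∈ B i}, Z ω ∂P = 0 := by
  induction k with
  | zero =>
    intro n Z B _ hZ h0 _
    simpa using (condExp_eq_zero_iff (hX.measurable n).comap_le hZ).1 h0 univ .univ
  | succ k ih =>
    intro n Z B hZm hZ h0 hB
    have hn : MeasurableSpace.comap (X n) inferInstance ≤ mΩ := (hX.measurable n).comap_le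
    have hB0 : MeasurableSet[MeasurableSpace.comap (X n) inferInstance] (X n ⁻¹' B 0) :=
      ⟨B 0, hB 0, rfl⟩
    have hset : {ω | ∀ i < k + 1, X (n + i) ω ∈ B i} =
        {ω | ∀ i < k, X (n + 1 + i) ω ∈ B (i + 1)} ∩ X n ⁻¹' B 0 := by
      ext ω
      simp only [mem_ofPred_eq, mem_inter_iff, mem_preimage]
      constructor
      · intro h
        refine ⟨fun i hi => ?_, by simpa using h 0 (by omega)⟩
        have := h (i + 1) (by omega)
        push_cast at this
        rwa [add_assoc, add_comm 1 (i : ℤ)]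
      · rintro ⟨h1, h2⟩ (_ | i) hi
        · simpa using h2
        · have := h1 i (by omega)
          push_cast
          rwa [add_assoc, add_comm 1 (i : ℤ)] at this
    have hZ' : Integrable ((X n ⁻¹' B 0).indicator Z) P := hZ.indicator (hn _ hB0)
    have hZ0 : P[(X n ⁻¹' B 0).indicator Z | MeasurableSpace.comap (X n) inferInstance] =ᵐ[P] 0 := by
      filter_upwards [condExp_indicator hZ hB0, h0] with ω h1 h2
      rw [h1]
      by_cases h : ω ∈ X n ⁻¹' B 0 <;> simp [h, h2]
    have hZm' : StronglyMeasurable[sigmaOf X (Iic n)] ((X n ⁻¹' B 0).indicator Z) :=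
      hZm.indicator (comap_le_sigmaOf X (mem_Iic.2 le_rfl) _ hB0)
    rw [hset, ← setIntegral_indicator (hn _ hB0)]
    exact ih (hZm'.mono (sigmaOf_mono X (Iic_subset_Iic.2 (by omega)))) hZ'
      (hX.condExp_succ_eq_zero hZm' hZ' hZ0) fun i => hB (i + 1)

/-- A variable of the past that is orthogonal to the present is orthogonal to the whole future. -/
lemma setIntegral_future_eq_zero {n : ℤ} {Z : Ω → ℝ}
    (hZm : StronglyMeasurable[sigmaOf X (Iic n)] Z) (hZ : Integrable Z P)
    (h0 : P[Z | MeasurableSpace.comap (X n) inferInstance] =ᵐ[P] 0) {B : Set Ω}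
    (hB : MeasurableSet[sigmaOf X (Ici n)] B) : ∫ ω in B, Z ω ∂P = 0 := by
  classical
  have hle := sigmaOf_le hX.measurable (Ici n)
  have huniv : ∫ ω, Z ω ∂P = 0 := by
    simpa using (condExp_eq_zero_iff (hX.measurable n).comap_le hZ).1 h0 univ .univ
  induction B, hB using MeasurableSpace.induction_on_inter
    (generateFrom_piiUnionInter_measurableSet
      (fun i => MeasurableSpace.comap (X i) inferInstance) (Ici n)).symm
    (isPiSystem_piiUnionInter _ (fun i =>
      @MeasurableSpace.isPiSystem_measurableSet Ω (MeasurableSpace.comap (X i) inferInstance)) _) with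
  | empty => simp
  | basic t ht =>
    obtain ⟨T, hT, f, hf, rfl⟩ := ht
    choose! B hB hfB using hf
    obtain ⟨k, hk⟩ : ∃ k : ℕ, ∀ i ∈ T, i < n + k := by
      refine ⟨T.sup (fun i => (i - n).toNat) + 1, fun i hi => ?_⟩
      have := Finset.le_sup (f := fun i => (i - n).toNat) hi
      have h2 := Int.self_le_toNat (i - n)
      push_cast
      omega
    have := hX.setIntegral_cylinder_eq_zero k (n := n)
      (B := fun i => if n + i ∈ T then B (n + i) else univ) hZm hZ h0 fun i => by
        split_ifs with h
        exacts [hB _ h, .univ]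
    convert this using 3
    ext ω
    simp only [mem_iInter, mem_ofPred_eq]
    constructor
    · intro h i _
      split_ifs with hi
      · have := h _ hi
        rwa [← hfB _ hi] at this
      · trivial
    · intro h i hi
      obtain ⟨j, rfl⟩ := Int.le.dest (hT hi)
      have := h j (by have := hk _ hi; omega)
      rw [if_pos hi] at this
      rw [← hfB _ hi]
      exact this
  | compl t ht ih =>
    rw [setIntegral_compl (hle _ ht) hZ, ih, huniv, sub_zero]
  | iUnion f hd hf ih =>
    rw [integral_iUnion (fun i => hle _ (hf i)) hd hZ.integrableOn]
    simp [ih]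

/-- Past and future are conditionally independent given the present. -/
lemma measureReal_inter_eq {n : ℤ} {A B : Set Ω} (hA : MeasurableSet[sigmaOf X (Iic n)] A)
    (hB : MeasurableSet[sigmaOf X (Ici n)] B) :
    P.real (A ∩ B) = ∫ ω, (P⟦A | MeasurableSpace.comap (X n) inferInstance⟧) ω *
      (P⟦B | MeasurableSpace.comap (X n) inferInstance⟧) ω ∂P := by
  have hn : MeasurableSpace.comap (X n) inferInstance ≤ mΩ := (hX.measurable n).comap_le
  have hA' := sigmaOf_le hX.measurable _ _ hA
  have hB' := sigmaOf_le hX.measurable _ _ hB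
  set φ := P⟦A | MeasurableSpace.comap (X n) inferInstance⟧ with hφ
  have hφi : Integrable φ P := integrable_condExp
  have hAi : Integrable (A.indicator fun _ => (1 : ℝ)) P := integrable_indicator_one hA'
  have hBi : Integrable (B.indicator fun _ => (1 : ℝ)) P := integrable_indicator_one hB'
  have h0 : P[(A.indicator fun _ => (1 : ℝ)) - φ | MeasurableSpace.comap (X n) inferInstance]
      =ᵐ[P] 0 := by
    refine (condExp_sub hAi hφi _).trans ?_
    rw [condExp_of_stronglyMeasurable hn stronglyMeasurable_condExp hφi, ← hφ, sub_self]
  have hm : StronglyMeasurable[sigmaOf X (Iic n)] ((A.indicator fun _ => (1 : ℝ)) - φ) := by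
    refine (stronglyMeasurable_const.indicator hA).sub ?_
    exact stronglyMeasurable_condExp.mono (comap_le_sigmaOf X (mem_Iic.2 le_rfl))
  have h1 := hX.setIntegral_future_eq_zero hm (hAi.sub hφi) h0 hB
  simp only [Pi.sub_apply] at h1
  rw [integral_sub hAi.integrableOn hφi.integrableOn, sub_eq_zero, setIntegral_indicator hA',
    setIntegral_const, smul_eq_mul, mul_one, inter_comm] at h1
  have hint : Integrable (φ * B.indicator fun _ => (1 : ℝ)) P := by
    refine hφi.mul_bdd (c := 1) hBi.aestronglyMeasurable (Eventually.of_forall fun ω => ?_)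
    by_cases h : ω ∈ B <;> simp [h]
  rw [h1, ← integral_indicator hB']
  calc ∫ ω, B.indicator φ ω ∂P = ∫ ω, (φ * B.indicator fun _ => (1 : ℝ)) ω ∂P := by
        refine integral_congr_ae (Eventually.of_forall fun ω => ?_)
        by_cases h : ω ∈ B <;> simp [h]
    _ = ∫ ω, (P[φ * B.indicator fun _ => (1 : ℝ) | MeasurableSpace.comap (X n) inferInstance]) ω ∂P :=
        (integral_condExp hn).symm
    _ = _ := integral_congr_ae
        (condExp_mul_of_stronglyMeasurable_left stronglyMeasurable_condExp hint hBi)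

end IsMarkovChain

/-- If `A` and `B` are conditionally independent given `m`, then some event of `m` is at least as
correlated with `B` as `A` is: the correlation is an average, with weights in `[0, 1]`, of the
excess of the conditional probability of `B` over its probability, so a set where this excess
has constant sign does at least as well. -/
lemma exists_correlation_ge (hm : m ≤ mΩ) {A B : Set Ω}
    (hA : MeasurableSet A) (hB : MeasurableSet B)
    (h : P.real (A ∩ B) = ∫ ω, (P⟦A | m⟧) ω * (P⟦B | m⟧) ω ∂P) :
    ∃ A', MeasurableSet[m] A' ∧
      |P.real (A ∩ B) - P.real A * P.real B| ≤ |P.real (A' ∩ B) - P.real A' * P.real B| := by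
  set φ := P⟦A | m⟧ with hφ
  set w : Ω → ℝ := fun ω => (P⟦B | m⟧) ω - P.real B with hw
  have hφi : Integrable φ P := integrable_condExp
  have hψi : Integrable (P⟦B | m⟧) P := integrable_condExp
  have hwi : Integrable w P := hψi.sub (integrable_const _)
  have hφm : ∀ᵐ ω ∂P, φ ω ∈ Icc (0 : ℝ) 1 := condExp_indicator_mem hA
  have hbd : ∀ {g : Ω → ℝ}, Integrable g P → Integrable (fun ω => φ ω * g ω) P := fun hg => by
    refine hg.bdd_mul (c := 1) hφi.aestronglyMeasurable ?_
    filter_upwards [hφm] with ω hω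
    rw [Real.norm_eq_abs, abs_of_nonneg hω.1]
    exact hω.2
  have hval : P.real (A ∩ B) - P.real A * P.real B = ∫ ω, φ ω * w ω ∂P := by
    have h1 : ∫ ω, φ ω ∂P = P.real A := by
      rw [hφ, integral_condExp hm, integral_indicator_const _ hA, smul_eq_mul, mul_one]
    simp only [hw, mul_sub]
    rw [integral_sub (hbd hψi) (hφi.mul_const _), integral_mul_const, h1, h]
  have hset : ∀ s, MeasurableSet[m] s → ∫ ω in s, w ω ∂P = P.real (s ∩ B) - P.real s * P.real B := by
    intro s hs
    simp only [hw]
    rw [integral_sub hψi.integrableOn (integrable_const _),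
      setIntegral_condExp hm (integrable_indicator_one hB) hs, setIntegral_indicator hB,
      setIntegral_const, setIntegral_const, smul_eq_mul, smul_eq_mul, mul_one]
  have hpos : MeasurableSet[m] {ω | 0 < w ω} :=
    (measurableSet_lt measurable_const (stronglyMeasurable_condExp.measurable.sub_const _))
  have hpos' := hm _ hpos
  have hle : ∫ ω, φ ω * w ω ∂P ≤ ∫ ω in {ω | 0 < w ω}, w ω ∂P := by
    rw [← integral_indicator hpos']
    refine integral_mono_ae (hbd hwi) (hwi.indicator hpos') ?_
    filter_upwards [hφm] with ω hω
    by_cases hs : 0 < w ω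
    · simp only [indicator, mem_ofPred_eq, hs, if_true]
      nlinarith [hω.2]
    · simp only [indicator, mem_ofPred_eq, hs, if_false]
      nlinarith [hω.1]
  have hge : ∫ ω in {ω | 0 < w ω}ᶜ, w ω ∂P ≤ ∫ ω, φ ω * w ω ∂P := by
    rw [← integral_indicator hpos'.compl]
    refine integral_mono_ae (hwi.indicator hpos'.compl) (hbd hwi) ?_
    filter_upwards [hφm] with ω hω
    by_cases hs : 0 < w ω
    · simp only [indicator, mem_compl_iff, mem_ofPred_eq, hs, not_true, if_false]
      nlinarith [hω.1]
    · simp only [indicator, mem_compl_iff, mem_ofPred_eq, hs, not_false_iff, if_true]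
      nlinarith [hω.2]
  rw [hset _ hpos, ← hval] at hle
  rw [hset _ hpos.compl, ← hval] at hge
  rcases le_total 0 (P.real (A ∩ B) - P.real A * P.real B) with h0 | h0
  · refine ⟨_, hpos, ?_⟩
    rw [abs_of_nonneg h0]
    exact hle.trans (le_abs_self _)
  · refine ⟨_, hpos.compl, ?_⟩
    rw [abs_of_nonpos h0]
    exact (neg_le_neg hge).trans (neg_le_abs _)

/-- The dependence between the past up to time `0` and the future from time `n` on is already
realized by the pair `(X 0, X n)`. -/
lemma IsMarkovChain.exists_correlation_ge {X : ℤ → Ω → ℝ} (hX : IsMarkovChain X P) (n : ℕ)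
    {A B : Set Ω} (hA : MeasurableSet[sigmaOf X (Iic 0)] A)
    (hB : MeasurableSet[sigmaOf X (Ici (n : ℤ))] B) :
    ∃ S T : Set ℝ, MeasurableSet S ∧ MeasurableSet T ∧
      |P.real (A ∩ B) - P.real A * P.real B| ≤
        |P.real (X 0 ⁻¹' S ∩ X n ⁻¹' T) - P.real (X 0 ⁻¹' S) * P.real (X n ⁻¹' T)| := by
  have hA' := sigmaOf_le hX.measurable _ _ hA
  have hB' := sigmaOf_le hX.measurable _ _ hB
  have hn : (0 : ℤ) ≤ n := by positivity
  have hB0 := sigmaOf_mono X (Ici_subset_Ici.2 hn) _ hB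
  obtain ⟨_, ⟨S, hS, rfl⟩, h1⟩ := _root_.exists_correlation_ge (hX.measurable 0).comap_le hA' hB'
    (hX.measureReal_inter_eq hA hB0)
  have hSn : MeasurableSet[sigmaOf X (Iic (n : ℤ))] (X 0 ⁻¹' S) :=
    comap_le_sigmaOf X (mem_Iic.2 hn) _ ⟨S, hS, rfl⟩
  have h2 := hX.measureReal_inter_eq hSn hB
  simp_rw [inter_comm (X 0 ⁻¹' S) B, mul_comm] at h2
  obtain ⟨_, ⟨T, hT, rfl⟩, h3⟩ := _root_.exists_correlation_ge (hX.measurable n).comap_le hB'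
    (hX.measurable 0 hS) (by simpa only [mul_comm] using h2)
  refine ⟨S, T, hS, hT, h1.trans ?_⟩
  simpa only [inter_comm, mul_comm] using h3

end MarkovProperty

/-! ### Markov chains generated by a copula -/

section Generated

variable {Ω : Type*} [MeasurableSpace Ω] {P : Measure Ω} [IsProbabilityMeasure P]

/-- If `V` is uniform on `[0, 1]` and the distribution function of `V` on the event `A` has density
`φ`, then `φ (V)` is the conditional probability of `A` given `V`. -/
lemma condExp_eq_density {V : Ω → ℝ}
    (hV : MeasurePreserving V P ((volume : Measure ℝ).restrict (Icc 0 1))) {A : Set Ω}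
    (hA : MeasurableSet A) {φ : ℝ → ℝ} (hφ : Measurable φ)
    (hφ01 : ∀ᵐ x ∂((volume : Measure ℝ).restrict (Icc 0 1)), φ x ∈ Icc (0 : ℝ) 1)
    (h : ∀ t ∈ Icc (0 : ℝ) 1, P.real (A ∩ V ⁻¹' Iic t) = ∫ x in (0 : ℝ)..t, φ x) :
    P⟦A | MeasurableSpace.comap V inferInstance⟧ =ᵐ[P] fun ω => φ (V ω) := by
  set π : Measure ℝ := (volume : Measure ℝ).restrict (Icc 0 1) with hπ
  have hφi : Integrable φ π := by
    refine Integrable.of_bound hφ.aestronglyMeasurable 1 ?_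
    filter_upwards [hφ01] with x hx
    rw [Real.norm_eq_abs, abs_of_nonneg hx.1]
    exact hx.2
  have hφV : Integrable (fun ω => φ (V ω)) P := hV.integrable_comp_of_integrable hφi
  have hν : (P.restrict A).map V = π.withDensity fun x => ENNReal.ofReal (φ x) := by
    refine Measure.ext_of_Iic _ _ fun t => ?_
    have hclamp : (Iic t : Set ℝ) =ᵐ[π] Iic (max 0 (min 1 t)) := by
      refine Filter.eventuallyEq_set.2 ?_
      filter_upwards [Copula.ae_mem_Ioo] with x hx
      rw [mem_Iic, mem_Iic, le_max_iff, le_min_iff]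
      exact ⟨fun h => Or.inr ⟨hx.2.le, h⟩, fun h => (h.resolve_left (not_le.2 hx.1)).2⟩
    have hc := Copula.clamp_mem t
    set c := max 0 (min 1 t)
    rw [Measure.map_apply hV.measurable measurableSet_Iic,
      Measure.restrict_apply (hV.measurable measurableSet_Iic),
      withDensity_apply _ measurableSet_Iic, Measure.restrict_congr_set hclamp,
      ← ofReal_integral_eq_lintegral_ofReal hφi.integrableOn
        (ae_restrict_of_ae (hφ01.mono fun x hx => hx.1))]
    have h1 : P (V ⁻¹' Iic t ∩ A) = P (A ∩ V ⁻¹' Iic c) := by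
      rw [inter_comm]
      exact measure_congr
        (EventuallyEq.rfl.inter (hV.quasiMeasurePreserving.preimage_ae_eq hclamp))
    have h2 : ∫ x in Iic c, φ x ∂π = ∫ x in (0 : ℝ)..c, φ x := by
      have hs : Iic c ∩ Icc (0 : ℝ) 1 = Icc 0 c := by
        ext z; simp only [mem_inter_iff, mem_Iic, mem_Icc]
        exact ⟨fun h => ⟨h.2.1, h.1⟩, fun h => ⟨h.2, h.1, h.2.trans hc.2⟩⟩
      rw [hπ, Measure.restrict_restrict measurableSet_Iic, hs, integral_Icc_eq_integral_Ioc,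
        intervalIntegral.integral_of_le hc.1]
    rw [h1, h2, ← h c hc, measureReal_def, ENNReal.ofReal_toReal (measure_ne_top _ _)]
  symm
  refine ae_eq_condExp_of_forall_setIntegral_eq hV.measurable.comap_le
    ((integrable_const _).indicator hA) (fun _ _ _ => hφV.integrableOn) ?_ ?_
  · rintro _ ⟨B, hB, rfl⟩ _
    have hB' := hV.measurable hB
    rw [setIntegral_indicator hA, setIntegral_const, smul_eq_mul, mul_one, measureReal_def,
      ← Measure.restrict_apply hB', ← Measure.map_apply hV.measurable hB, hν,
      withDensity_apply _ hB, ← ofReal_integral_eq_lintegral_ofReal hφi.integrableOn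
        (ae_restrict_of_ae (hφ01.mono fun x hx => hx.1)), ENNReal.toReal_ofReal
        (setIntegral_nonneg_of_ae (hφ01.mono fun x hx => hx.1)), ← hV.map_eq,
      setIntegral_map hB hφ.aestronglyMeasurable hV.measurable.aemeasurable]
  · exact (hφ.comp (comap_measurable V)).aestronglyMeasurable

lemma zero_mem_correlations (X : ℤ → Ω → ℝ) (P : Measure Ω) (n : ℕ) :
    (0 : ℝ) ∈ {r : ℝ | ∃ A B : Set Ω, MeasurableSet[sigmaOf X (Iic 0)] A ∧
      MeasurableSet[sigmaOf X (Ici (n : ℤ))] B ∧ r = |P.real (A ∩ B) - P.real A * P.real B|} :=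
  ⟨∅, ∅, @MeasurableSet.empty Ω (sigmaOf X (Iic 0)),
    @MeasurableSet.empty Ω (sigmaOf X (Ici (n : ℤ))), by simp⟩

namespace IsGeneratedByCopula

variable {X : ℤ → Ω → ℝ} {C : Copula} (hX : IsGeneratedByCopula X P C)
include hX

lemma measurePreserving (n : ℤ) :
    MeasurePreserving (X n) P ((volume : Measure ℝ).restrict (Icc 0 1)) :=
  ⟨hX.isMarkovChain.measurable n, hX.uniform n⟩

/-- The distribution function of `(X 0, X n)` is the `n`-th power of the copula. -/
lemma measureReal_Iic_inter_Iic {n : ℕ} (hn : 1 ≤ n) : ∀ u ∈ Icc (0 : ℝ) 1, ∀ v ∈ Icc (0 : ℝ) 1,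
    P.real (X 0 ⁻¹' Iic u ∩ X n ⁻¹' Iic v) = C.foldPow n u v := by
  induction n, hn using Nat.le_induction with
  | base => exact fun u hu v hv => hX.joint 0 u hu v hv
  | succ n hn ih =>
    intro u hu v hv
    have hpow : C.foldPow (n + 1) = (C.foldPow n).fold C := by
      obtain ⟨k, rfl⟩ := Nat.exists_eq_add_of_le' hn
      rfl
    have hX0 := hX.isMarkovChain.measurable 0 (measurableSet_Iic (a := u))
    have hXn := hX.isMarkovChain.measurable (n + 1) (measurableSet_Iic (a := v))
    have hpast : MeasurableSet[sigmaOf X (Iic (n : ℤ))] (X 0 ⁻¹' Iic u) :=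
      comap_le_sigmaOf X (mem_Iic.2 (by positivity)) _ ⟨_, measurableSet_Iic, rfl⟩
    have hfut : MeasurableSet[sigmaOf X (Ici (n : ℤ))] (X (n + 1) ⁻¹' Iic v) :=
      comap_le_sigmaOf X (mem_Ici.2 (by omega)) _ ⟨_, measurableSet_Iic, rfl⟩
    have hV := hX.measurePreserving n
    have hm2 : Measurable fun t => (C.foldPow n).d2 u t := (C.foldPow n).transpose.measurable_d1 u
    have hm1 : Measurable fun t => C.d1 t v := C.measurable_d1 v
    have hm : Measurable fun t => (C.foldPow n).d2 u t * C.d1 t v := hm2.mul hm1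
    have h1 := condExp_eq_density hV hX0 hm2 ((C.foldPow n).transpose.d1_mem hu) fun t ht => by
      rw [ih u hu t ht]
      have := (C.foldPow n).transpose.integral_d1 hu (a := 0) (b := t) (by simp) ht
      refine Eq.trans ?_ this.symm
      rw [(C.foldPow n).transpose.zero_left u hu, sub_zero]
      rfl
    have h2 := condExp_eq_density hV hXn hm1 (C.d1_mem hv) fun t ht => by
      rw [C.integral_d1 hv (by simp) ht, C.zero_left v hv, sub_zero, inter_comm]
      exact hX.joint n t ht v hv
    push_cast
    rw [hX.isMarkovChain.measureReal_inter_eq hpast hfut, hpow]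
    change _ = ∫ t in (0 : ℝ)..1, (C.foldPow n).d2 u t * C.d1 t v
    rw [← Copula.integral_Icc_eq, ← hV.map_eq, integral_map hV.measurable.aemeasurable
      hm.aestronglyMeasurable]
    refine integral_congr_ae ?_
    filter_upwards [h1, h2] with ω e1 e2
    rw [e1, e2]

/-- The law of `(X 0, X n)` is the one that belongs to the `n`-th power of the copula. -/
lemma measureReal_inter_eq_measure {n : ℕ} (hn : 1 ≤ n) {A B : Set ℝ} (hA : MeasurableSet A)
    (hB : MeasurableSet B) :
    P.real (X 0 ⁻¹' A ∩ X n ⁻¹' B) = (C.foldPow n).measure.real (A ×ˢ B) := by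
  have hm : Measurable fun ω => (X 0 ω, X n ω) :=
    (hX.isMarkovChain.measurable 0).prodMk (hX.isMarkovChain.measurable n)
  have : IsProbabilityMeasure (P.map fun ω => (X 0 ω, X n ω)) :=
    Measure.isProbabilityMeasure_map hm.aemeasurable
  rw [← (C.foldPow n).eq_measure (μ := P.map fun ω => (X 0 ω, X n ω)) fun u hu v hv => by
    rw [map_measureReal_apply hm (measurableSet_Iic.prod measurableSet_Iic)]
    exact hX.measureReal_Iic_inter_Iic hn u hu v hv,
    map_measureReal_apply hm (hA.prod hB)]
  rfl

lemma measureReal_preimage (n : ℤ) {A : Set ℝ} (hA : MeasurableSet A) :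
    P.real (X n ⁻¹' A) = ((volume : Measure ℝ).restrict (Icc 0 1)).real A :=
  (hX.measurePreserving n).measureReal_preimage hA.nullMeasurableSet

/-- The mixing coefficients of the chain are bounded by the dependence between `X 0` and `X n`. -/
lemma processAlpha_le (n : ℕ) {r : ℝ} (h : ∀ A B : Set ℝ, MeasurableSet A → MeasurableSet B →
    |P.real (X 0 ⁻¹' A ∩ X n ⁻¹' B) - ((volume : Measure ℝ).restrict (Icc 0 1)).real A *
      ((volume : Measure ℝ).restrict (Icc 0 1)).real B| ≤ r) : processAlpha X P n ≤ r := by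
  refine csSup_le ⟨0, zero_mem_correlations X P _⟩ ?_
  rintro _ ⟨A, B, hA, hB, rfl⟩
  obtain ⟨S, T, hS, hT, hle⟩ := hX.isMarkovChain.exists_correlation_ge n hA hB
  refine hle.trans ?_
  rw [hX.measureReal_preimage 0 hS, hX.measureReal_preimage n hT]
  exact h S T hS hT

lemma processAlpha_le_alphaN {n : ℕ} (hn : 1 ≤ n) : processAlpha X P n ≤ C.alphaN n :=
  hX.processAlpha_le n fun A B hA hB => by
    rw [hX.measureReal_inter_eq_measure hn hA hB]
    exact (C.foldPow n).abs_measure_sub_le_alpha hA hB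

lemma processAlpha_bddAbove (n : ℕ) : BddAbove {r : ℝ | ∃ A B : Set Ω,
    MeasurableSet[sigmaOf X (Iic 0)] A ∧ MeasurableSet[sigmaOf X (Ici (n : ℤ))] B ∧
      r = |P.real (A ∩ B) - P.real A * P.real B|} := by
  refine ⟨1 / 4, ?_⟩
  rintro _ ⟨A, B, -, hB, rfl⟩
  exact abs_measureReal_inter_sub_le P (sigmaOf_le hX.isMarkovChain.measurable _ _ hB)

lemma processAlpha_nonneg (n : ℕ) : 0 ≤ processAlpha X P n :=
  le_csSup (hX.processAlpha_bddAbove n) (zero_mem_correlations X P n)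

lemma processAlpha_antitone : Antitone (processAlpha X P) := by
  intro m n hmn
  refine csSup_le_csSup (hX.processAlpha_bddAbove m) ⟨0, zero_mem_correlations X P _⟩ ?_
  rintro _ ⟨A, B, hA, hB, rfl⟩
  exact ⟨A, B, hA, sigmaOf_mono X (Ici_subset_Ici.2 (by exact_mod_cast hmn)) _ hB, rfl⟩

lemma measurable_path : Measurable fun ω i => X i ω :=
  measurable_pi_lambda _ fun n => hX.isMarkovChain.measurable n

lemma isStationaryMarkov (hs : IsStrictlyStationary X P) :
    IsStationaryMarkov X P ((volume : Measure ℝ).restrict (Icc 0 1)) where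
  measurePreserving := hX.measurePreserving
  shift m n A B hA hB := by
    have hset : MeasurableSet {x : ℤ → ℝ | x m ∈ A ∧ x n ∈ B} :=
      (measurable_pi_apply m hA).inter (measurable_pi_apply n hB)
    have h := hs.measure_preimage hset.nullMeasurableSet
    rw [pathLaw, Measure.map_apply hX.measurable_path (hs.measurable hset),
      Measure.map_apply hX.measurable_path hset] at h
    exact h
  markov m n A B hmn hA hB := hX.isMarkovChain.measureReal_inter_eq
    (comap_le_sigmaOf X (mem_Iic.2 hmn) _ ⟨A, hA, rfl⟩)
    (comap_le_sigmaOf X (mem_Ici.2 (by omega)) _ ⟨B, hB, rfl⟩)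

/-- In an ergodic chain a set of states that cannot be entered or left has probability `0`
or `1`. -/
lemma trivial_of_invariant (herg : IsErgodicProcess X P) {W : Set ℝ} (hW : MeasurableSet W)
    (h : X 1 ⁻¹' W =ᵐ[P] X 0 ⁻¹' W) : ((volume : Measure ℝ).restrict (Icc 0 1)) W = 0 ∨
      ((volume : Measure ℝ).restrict (Icc 0 1)) W = 1 := by
  have hE : MeasurableSet {x : ℤ → ℝ | x 0 ∈ W} := measurable_pi_apply 0 hW
  have hval : pathLaw X P {x : ℤ → ℝ | x 0 ∈ W} = ((volume : Measure ℝ).restrict (Icc 0 1)) W := by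
    rw [pathLaw, Measure.map_apply hX.measurable_path hE,
      ← (hX.measurePreserving 0).measure_preimage hW.nullMeasurableSet]
    rfl
  have huniv : pathLaw X P univ = 1 := by
    rw [pathLaw, Measure.map_apply hX.measurable_path .univ, preimage_univ, measure_univ]
  have hinv : seqShift ⁻¹' {x : ℤ → ℝ | x 0 ∈ W} =ᵐ[pathLaw X P] {x : ℤ → ℝ | x 0 ∈ W} := by
    have hE1 : MeasurableSet {x : ℤ → ℝ | x 1 ∈ W} := measurable_pi_apply 1 hW
    refine Filter.eventuallyEq_set.2 ?_
    rw [pathLaw, ae_map_iff hX.measurable_path.aemeasurable]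
    · exact h.mem_iff
    · exact (hE1.compl.union hE).inter (hE1.union hE.compl) |>.congr (by
        ext x
        simp only [mem_inter_iff, mem_union, mem_compl_iff, mem_ofPred_eq, mem_preimage, seqShift,
          zero_add]
        tauto)
  rw [← hval]
  rcases herg.quasiErgodic.ae_empty_or_univ₀ hE.nullMeasurableSet hinv with h0 | h1
  · exact Or.inl (by rw [measure_congr h0, measure_empty])
  · exact Or.inr (by rw [measure_congr h1, huniv])

/-- If `α_s (C) < 1 / 4`, no set of measure close to `1 / 2` is nearly deterministic at time `s`. -/
lemma exists_balanced_gap {s : ℕ} (hs : 1 ≤ s) (hα : C.alphaN s < 1 / 4) : ∃ ε > 0, ∀ A,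
    NearDet X P s ε A → ε ≤ |((volume : Measure ℝ).restrict (Icc 0 1)).real A - 1 / 2| := by
  set ε := (1 / 4 - C.alphaN s) / 4 with hε
  have hα0 : 0 ≤ C.alphaN s :=
    (abs_nonneg _).trans ((C.foldPow s).abs_measure_sub_le_alpha .empty .empty)
  refine ⟨ε, by linarith, fun A hA => ?_⟩
  by_contra! hlt
  obtain ⟨hAm, B, hB, hle⟩ := hA
  have hXA := hX.isMarkovChain.measurable s hAm
  have hXB := hX.isMarkovChain.measurable 0 hB
  have h1 := (le_abs_self _).trans ((C.foldPow s).abs_measure_sub_le_alpha hB hAm)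
  rw [← hX.measureReal_inter_eq_measure hs hB hAm, ← hX.measureReal_preimage s hAm,
    ← hX.measureReal_preimage 0 hB] at h1
  change _ ≤ C.alphaN s at h1
  rw [← hX.measureReal_preimage s hAm] at hlt
  rw [measureReal_symmDiff_eq hXA hXB] at hle
  have h2 := measureReal_inter_add_sdiff (μ := P) (s := X s ⁻¹' A) hXB
  have h3 := measureReal_inter_add_sdiff (μ := P) (s := X 0 ⁻¹' B) hXA
  rw [inter_comm] at h2
  have h4 : 0 ≤ P.real (X s ⁻¹' A \ X 0 ⁻¹' B) := measureReal_nonneg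
  have h5 : 0 ≤ P.real (X 0 ⁻¹' B \ X s ⁻¹' A) := measureReal_nonneg
  have h6 : P.real (X s ⁻¹' A) ≤ 1 := measureReal_le_one
  have h7 : 0 ≤ P.real (X s ⁻¹' A) := measureReal_nonneg
  set a := P.real (X s ⁻¹' A)
  set b := P.real (X 0 ⁻¹' B)
  have h8 : (a - 1 / 2) ^ 2 ≤ ε := by
    rw [← sq_abs]
    nlinarith [abs_nonneg (a - 1 / 2)]
  have h9 : a * b ≤ a * (a + ε) := mul_le_mul_of_nonneg_left (by linarith) h7
  nlinarith

/-- A strictly stationary, ergodic and aperiodic chain generated by a copula with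
`α_s (C) < 1 / 4` is `α`-mixing. -/
theorem isAlphaMixing (hstat : IsStrictlyStationary X P) (herg : IsErgodicProcess X P)
    (haper : IsAperiodicChain X P) {s : ℕ} (hs : 1 ≤ s) (hα : C.alphaN s < 1 / 4) :
    IsAlphaMixing X P := by
  obtain ⟨ε, hε, hbal⟩ := hX.exists_balanced_gap hs hα
  rw [IsAlphaMixing, Metric.tendsto_atTop]
  intro c hc
  obtain ⟨N, hN⟩ := (hX.isStationaryMarkov hstat).exists_small_correlation
    (fun W hW h => hX.trivial_of_invariant herg hW h) haper hε hbal (half_pos hc)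
  refine ⟨N, fun n hn => ?_⟩
  have h1 : processAlpha X P N ≤ c / 2 := hX.processAlpha_le N fun A B hA hB => by
    have := hN B A hB hA
    rw [inter_comm, mul_comm] at this
    exact this.le
  rw [Real.dist_eq, sub_zero, abs_of_nonneg (hX.processAlpha_nonneg n)]
  linarith [hX.processAlpha_antitone hn]

end IsGeneratedByCopula

end Generated

theorem theorem2p3 {k : ℕ} (C : Fin k → Copula) (a : Fin k → ℝ)
    (ha : ∀ i, a i ∈ Set.Ioo (0 : ℝ) 1) (hsum : ∑ i, a i = 1)
    (s : ℕ) (hs : 1 ≤ s) (j : Fin s → Fin k)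
    (hα : (Copula.foldProd s fun l => C (j l)).alpha < 1 / 4) :
    (Copula.convexComb a C (fun i => (ha i).1.le) hsum).alphaN s < 1 / 4 ∧
    ∀ {Ω : Type*} [MeasurableSpace Ω] (P : Measure Ω) [IsProbabilityMeasure P] (X : ℤ → Ω → ℝ),
      IsGeneratedByCopula X P (Copula.convexComb a C (fun i => (ha i).1.le) hsum) →
      IsStrictlyStationary X P →
        processAlpha X P s < 1 / 4 ∧
        (IsErgodicProcess X P → IsAperiodicChain X P → IsAlphaMixing X P) := by
  have h := Copula.alphaN_convexComb_lt C a ha hsum s hs j hα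
  exact ⟨h, fun P _ X hX hstat => ⟨(hX.processAlpha_le_alphaN hs).trans_lt h,
    fun herg haper => hX.isAlphaMixing hstat herg haper hs h⟩⟩
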